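/- Let $X_0,X_1,\dots$ be independent complex random variables on a common probability space such that, for some $\alpha\in\mathbb{C}$ and every $j$, \[ \mathbb{E}X_j=0,\qquad \mathbb{E}X_j^2=\alpha,\qquad \mathbb{E}|X_j|^2=1 . \] Let $\mathcal{C}_n$ be the $n\times n$ circulant matrix with first row $X_0,\dots,X_{n-1}$, i.e. with $(i,j)$ entry $X_{(j-i)\bmod n}$, and let $\mu_n=\frac1n\sum_{k=0}^{n-1}\delta_{\lambda_k}$ be the empirical spectral measure of $n^{-1/2}\mathcal{C}_n$, where $\lambda_0,\dots,\lambda_{n-1}$ are its eigenvalues counted with multiplicity. For probability measures $\mu,\nu$ on $\mathbb{C}$ let \[ T(\mu,\nu)=\inf_{\pi\in\Pi(\mu,\nu)}\iint|x-y|^2\,d\pi(x,y), \] where $\Pi(\mu,\nu)$ is the set of probability measures on $\mathbb{C}\times\mathbb{C}$ with marginals $\mu$ and $\nu$, and let $H(\nu\,\|\,\mu)=\int\log\frac{d\nu}{d\mu}\,d\nu$ (with value $+\infty$ if $\nu\not\ll\mu$) be the entropy of $\nu$ relative to $\mu$. Suppose that, in addition, one of the following holds. 1. There exists $K>0$ such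 that, for each $j$, $|X_j|\le K$ almost surely. 2. There exists $K>0$ such that, for each $j$, the distribution $\mu$ of $X_j$ satisfies the quadratic transportation cost inequality with constant $K$, that is, $\sqrt{T(\mu,\nu)}\le\sqrt{2K\,H(\nu\,\|\,\mu)}$ for every probability measure $\nu$ on $\mathbb{C}$. 3. There exists $K>0$ such that, for each $j$, the distribution $\mu$ of $X_j$ satisfies $T(\mu,\nu)\le\sqrt{2K\,H(\nu\,\|\,\mu)}$ for every probability measure $\nu$ on $\mathbb{C}$. Then, almost surely, $\mu_n$ converges weak-$*$ as $n\to\infty$ to the standard complex Gaussian measure $\gamma_{\mathbb{C}}$, which has density $\frac1\pi e^{-|z|^2}$ with respect to Lebesgue measure on $\mathbb{C}$; that is, with probability one, $\int f\,d\mu_n\to\int f\,d\gamma_{\mathbb{C}}$ for every bounded continuous $f:\mathbb{C}\to\mathbb{R}$. -/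

import Mathlib

open MeasureTheory ProbabilityTheory Filter Topology
open scoped ENNReal BoundedContinuousFunction

noncomputable section

/-- The `n × n` circulant matrix with first row `x 0, …, x (n - 1)`: its `(i, j)` entry is
`x ((j - i) mod n)`. -/
def circulantRow (n : ℕ) (x : ℕ → ℂ) : Matrix (Fin n) (Fin n) ℂ :=
  (Matrix.circulant fun i : Fin n => x i).transpose

/-- The empirical spectral measure `n⁻¹ ∑ δ_λ` of a complex `n × n` matrix, where `λ` runs over
the eigenvalues counted with algebraic multiplicity. -/
def empiricalSpectralMeasure {n : ℕ} (A : Matrix (Fin n) (Fin n) ℂ) : Measure ℂ :=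
  (n : ℝ≥0∞)⁻¹ • (A.charpoly.roots.map fun z => Measure.dirac z).sum

/-- The empirical spectral measure of `n^{-1/2}` times the circulant matrix with first row
`x 0, …, x (n - 1)`. -/
def circulantSpectralMeasure (n : ℕ) (x : ℕ → ℂ) : Measure ℂ :=
  empiricalSpectralMeasure (((Real.sqrt n : ℝ) : ℂ)⁻¹ • circulantRow n x)

/-- The standard complex Gaussian measure, with density `π⁻¹ exp (-|z|²)` with respect to
Lebesgue measure on `ℂ`. -/
def stdComplexGaussian : Measure ℂ :=
  (volume : Measure ℂ).withDensity fun z =>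
    ENNReal.ofReal (1 / Real.pi * Real.exp (-‖z‖ ^ 2))

/-- Weak-* convergence of a sequence of finite measures on `ℂ`: convergence of the integrals of
all bounded continuous functions. -/
def WeakStarTendsto (μ : ℕ → Measure ℂ) (ν : Measure ℂ) : Prop :=
  ∀ f : ℂ →ᵇ ℝ, Tendsto (fun n => ∫ z, f z ∂(μ n)) atTop (𝓝 (∫ z, f z ∂ν))

/-- The couplings of `μ` and `ν`: measures on the product with marginals `μ` and `ν`. -/
def couplings (μ ν : Measure ℂ) : Set (Measure (ℂ × ℂ)) :=
  {π | π.map Prod.fst = μ ∧ π.map Prod.snd = ν}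

/-- The optimal quadratic transportation cost `inf_π ∬ |x - y|² dπ(x, y)` (the square of the
Wasserstein distance `W₂`). -/
def quadraticCost (μ ν : Measure ℂ) : ℝ≥0∞ :=
  ⨅ π ∈ couplings μ ν, ∫⁻ p, ENNReal.ofReal (‖p.1 - p.2‖ ^ 2) ∂π

/-- `μ` satisfies the quadratic transportation cost inequality with constant `K`:
`W₂(μ, ν) ≤ √(2 K H)` for every probability measure `ν`, where `H = ∫ log (dν/dμ) dν`
(`∞` unless `ν ≪ μ`) is the entropy of `ν` relative to `μ`. -/
def QuadraticTransportInequality (μ : Measure ℂ) (K : ℝ) : Prop :=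
  ∀ ν : Measure ℂ, IsProbabilityMeasure ν →
    quadraticCost μ ν ^ (1 / 2 : ℝ) ≤
      (ENNReal.ofReal (2 * K) * InformationTheory.klDiv ν μ) ^ (1 / 2 : ℝ)

/-- The variant of the preceding inequality in which the transportation cost itself, and not its
square root, is bounded: `inf_π ∬ |x - y|² dπ(x, y) ≤ √(2 K H)`. -/
def QuadraticTransportInequality' (μ : Measure ℂ) (K : ℝ) : Prop :=
  ∀ ν : Measure ℂ, IsProbabilityMeasure ν →
    quadraticCost μ ν ≤
      (ENNReal.ofReal (2 * K) * InformationTheory.klDiv ν μ) ^ (1 / 2 : ℝ)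

end

/-!
The eigenvalues of `n^{-1/2}` times the circulant matrix with first row `x` are the entries of the
unitary discrete Fourier transform of `(x 0, …, x (n - 1))`. Hence the characteristic function of
the spectral measure at `t` is an average of exponentials `exp (i ⟨λ_k, t⟩)`, and by Lévy's
convergence theorem it is enough to show that, almost surely, these averages converge to
`exp (-‖t‖² / 4)`, the characteristic function of the standard complex Gaussian, for all `t`.

**Tails.** All three alternatives are used only through a uniform polynomial tail bound
`P(‖X_j‖ ≥ s) ≤ C (1 + s)^{-48}` (`exists_uniform_tail`). For the transportation inequalities this
is Marton's argument: the law conditioned on `{‖z‖ ≥ 2 + s}` has relative entropy `-log` of the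
probability of that set, while transporting the law to it costs at least `3 s² / 4`, because a
mass of at least `3 / 4` sits in the disc of radius `2`.

**Means.** For each `k`, independence turns `E exp (i ⟨λ_k, t⟩)` into a product, which is compared
factor by factor with a Gaussian product by a second-order Taylor expansion. The variances add up
to exactly `‖t‖² / 2` unless `n ∣ 2k`, since the contribution of `α` is a sum of the squares of
`n`-th roots of unity; at most two values of `k` are exceptional
(`tendsto_integral_empiricalCharFun`).

**Concentration.** If zeroing one coordinate at a time changes a bounded function `F` of
independent variables so little that the squared changes add up to at most `V` at every point, then
the Efron–Stein inequality, applied to `F` and then to `(F - E F)²`, gives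
`E (F - E F)⁴ ≤ 11 V²` (`integral_sub_integral_pow_four_le`). For the real and imaginary parts of
the averages above and variables bounded by `K`, Parseval's identity gives `V = O(K⁴ / n)`.
Truncating at level `K = n^{1/16}`, which by the tail bound almost surely has no effect for large
`n`, makes the fourth moments `O(n^{-3/2})`, which is summable, so that almost sure convergence
follows (`ae_tendsto_sub_integral_truncate`).

**All `t` at once.** The averages are Lipschitz in `t` with a constant controlled by
`n⁻¹ ∑ ‖X_j‖²`, which is almost surely eventually at most `2` by the same concentration bound; so
convergence on a countable dense set of `t` suffices.
-/

/-! ### The spectrum of a circulant matrix -/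

/-- The primitive `n`-th root of unity `exp (2πi / n)`. -/
noncomputable def unitRoot (n : ℕ) : ℂ := Complex.exp (2 * Real.pi * Complex.I / n)

lemma isPrimitiveRoot_unitRoot (n : ℕ) [NeZero n] : IsPrimitiveRoot (unitRoot n) n :=
  Complex.isPrimitiveRoot_exp n (NeZero.ne n)

lemma unitRoot_pow_self (n : ℕ) [NeZero n] : unitRoot n ^ n = 1 :=
  (isPrimitiveRoot_unitRoot n).pow_eq_one

lemma norm_unitRoot (n : ℕ) [NeZero n] : ‖unitRoot n‖ = 1 :=
  (isPrimitiveRoot_unitRoot n).norm'_eq_one (NeZero.ne n)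

/-- The unitary matrix of the discrete Fourier transform, with positive exponents. -/
noncomputable def dftMatrix (n : ℕ) : Matrix (Fin n) (Fin n) ℂ :=
  Matrix.of fun j k => ((Real.sqrt n : ℝ) : ℂ)⁻¹ * unitRoot n ^ (j * k : ℕ)

/-- The unitary discrete Fourier transform `n^{-1/2} ∑_j y_j ζ^{jk}`, with positive exponents, so that
its entries are the eigenvalues of the normalized circulant matrix with first row `y`. -/
noncomputable def normalizedDFT {n : ℕ} (y : Fin n → ℂ) (k : Fin n) : ℂ :=
  ((Real.sqrt n : ℝ) : ℂ)⁻¹ * ∑ j, y j * unitRoot n ^ (j * k : ℕ)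

lemma sqrt_inv_mul_sqrt_inv (n : ℕ) :
    ((Real.sqrt n : ℝ) : ℂ)⁻¹ * ((Real.sqrt n : ℝ) : ℂ)⁻¹ = (n : ℂ)⁻¹ := by
  rw [← mul_inv, ← Complex.ofReal_mul, Real.mul_self_sqrt (Nat.cast_nonneg n)]
  simp

lemma conj_unitRoot (n : ℕ) [NeZero n] :
    star (unitRoot n) = (unitRoot n)⁻¹ :=
  (Complex.inv_eq_conj (norm_unitRoot n)).symm

lemma dftMatrix_conjTranspose_mul (n : ℕ) [NeZero n] :
    (dftMatrix n).conjTranspose * dftMatrix n = 1 := by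
  ext k l
  have hζ := isPrimitiveRoot_unitRoot n
  have hne : unitRoot n ≠ 0 := hζ.ne_zero (NeZero.ne n)
  have hn : (n : ℂ) ≠ 0 := Nat.cast_ne_zero.mpr (NeZero.ne n)
  have key : ∀ j : Fin n, star (dftMatrix n j k) * dftMatrix n j l =
      (n : ℂ)⁻¹ * (unitRoot n ^ (l : ℕ) * ((unitRoot n)⁻¹) ^ (k : ℕ)) ^ (j : ℕ) := by
    intro j
    simp only [dftMatrix, Matrix.of_apply, star_mul', star_inv₀, star_pow, conj_unitRoot]
    rw [show star ((Real.sqrt n : ℝ) : ℂ) = ((Real.sqrt n : ℝ) : ℂ) from Complex.conj_ofReal _,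
      ← sqrt_inv_mul_sqrt_inv, mul_pow, ← pow_mul, ← pow_mul, mul_comm (l : ℕ), mul_comm (k : ℕ)]
    ring
  simp only [Matrix.mul_apply, Matrix.conjTranspose_apply, key]
  rw [← Finset.mul_sum, Fin.sum_univ_eq_sum_range fun j =>
    (unitRoot n ^ (l : ℕ) * ((unitRoot n)⁻¹) ^ (k : ℕ)) ^ j]
  rcases eq_or_ne k l with rfl | hkl
  · rw [← mul_pow, mul_inv_cancel₀ hne]
    simp [hn]
  · have h1 : unitRoot n ^ (l : ℕ) * ((unitRoot n)⁻¹) ^ (k : ℕ) ≠ 1 := by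
      intro h
      rw [inv_pow, mul_inv_eq_one₀ (pow_ne_zero _ hne)] at h
      exact hkl (Fin.ext (hζ.pow_inj l.2 k.2 h).symm)
    have h2 : (unitRoot n ^ (l : ℕ) * ((unitRoot n)⁻¹) ^ (k : ℕ)) ^ n = 1 := by
      rw [mul_pow, ← pow_mul, ← pow_mul, mul_comm (l : ℕ), mul_comm (k : ℕ), pow_mul, pow_mul,
        inv_pow, unitRoot_pow_self]
      simp
    rw [geom_sum_eq h1, h2]
    simp [hkl]

lemma normalizedDFT_eq_mulVec {n : ℕ} (y : Fin n → ℂ) :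
    normalizedDFT y = (dftMatrix n).mulVec y := by
  ext k
  simp only [normalizedDFT, Matrix.mulVec, dotProduct, dftMatrix, Matrix.of_apply, Finset.mul_sum]
  refine Finset.sum_congr rfl fun j _ => ?_
  rw [mul_comm (k : ℕ)]
  ring

/-- Parseval's identity. -/
lemma sum_norm_sq_normalizedDFT {n : ℕ} (y : Fin n → ℂ) :
    ∑ k, ‖normalizedDFT y k‖ ^ 2 = ∑ j, ‖y j‖ ^ 2 := by
  rcases Nat.eq_zero_or_pos n with rfl | hn
  · simp
  have : NeZero n := ⟨hn.ne'⟩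
  have hz : ∀ v : Fin n → ℂ, ((∑ k, ‖v k‖ ^ 2 : ℝ) : ℂ) = dotProduct (star v) v := by
    intro v
    simp only [dotProduct, Pi.star_apply, Complex.ofReal_sum, Complex.ofReal_pow]
    refine Finset.sum_congr rfl fun k _ => ?_
    exact (Complex.conj_mul' (v k)).symm
  apply Complex.ofReal_injective
  rw [hz, hz, normalizedDFT_eq_mulVec, Matrix.star_mulVec, Matrix.dotProduct_mulVec,
    Matrix.vecMul_vecMul, dftMatrix_conjTranspose_mul, Matrix.vecMul_one]

lemma unitRoot_pow_val_add {n : ℕ} [NeZero n] (i j : Fin n) (k : ℕ) :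
    unitRoot n ^ (((i + j : Fin n) : ℕ) * k) =
      unitRoot n ^ ((i : ℕ) * k) * unitRoot n ^ ((j : ℕ) * k) := by
  rw [Fin.val_add, pow_mul, ← pow_eq_pow_mod _ (unitRoot_pow_self n), ← pow_mul, add_mul, pow_add]

/-- The columns of the Fourier matrix are eigenvectors of every circulant matrix. -/
lemma circulantRow_mul_dftMatrix (n : ℕ) [NeZero n] (x : ℕ → ℂ) :
    (((Real.sqrt n : ℝ) : ℂ)⁻¹ • circulantRow n x) * dftMatrix n =
      dftMatrix n * Matrix.diagonal (normalizedDFT fun j : Fin n => x j) := by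
  ext i k
  rw [Matrix.mul_diagonal]
  simp only [Matrix.mul_apply, Matrix.smul_apply, circulantRow,
    Matrix.transpose_apply, Matrix.circulant_apply, dftMatrix, Matrix.of_apply, normalizedDFT,
    Finset.mul_sum, smul_eq_mul]
  rw [← Equiv.sum_comp (Equiv.addRight i)]
  refine Finset.sum_congr rfl fun j _ => ?_
  simp only [Equiv.coe_addRight, add_sub_cancel_right, unitRoot_pow_val_add]
  ring

lemma charpoly_circulantRow (n : ℕ) [NeZero n] (x : ℕ → ℂ) :
    (((Real.sqrt n : ℝ) : ℂ)⁻¹ • circulantRow n x).charpoly =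
      ∏ k, (Polynomial.X - Polynomial.C (normalizedDFT (fun j : Fin n => x j) k)) := by
  have h1 := dftMatrix_conjTranspose_mul n
  have h2 : dftMatrix n * (dftMatrix n).conjTranspose = 1 := mul_eq_one_comm.mp h1
  have h3 : ((Real.sqrt n : ℝ) : ℂ)⁻¹ • circulantRow n x =
      dftMatrix n * Matrix.diagonal (normalizedDFT fun j : Fin n => x j) *
        (dftMatrix n).conjTranspose := by
    rw [← circulantRow_mul_dftMatrix, mul_assoc, h2, mul_one]
  rw [h3, Matrix.charpoly_mul_comm, ← mul_assoc, h1, one_mul, Matrix.charpoly_diagonal]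

lemma circulantSpectralMeasure_eq (n : ℕ) [NeZero n] (x : ℕ → ℂ) :
    circulantSpectralMeasure n x =
      (n : ℝ≥0∞)⁻¹ • ∑ k, Measure.dirac (normalizedDFT (fun j : Fin n => x j) k) := by
  have h : (∏ k, (Polynomial.X -
      Polynomial.C (normalizedDFT (fun j : Fin n => x j) k))).roots =
      Finset.univ.val.map (normalizedDFT fun j : Fin n => x j) := by
    rw [← Polynomial.roots_multiset_prod_X_sub_C
      (Finset.univ.val.map (normalizedDFT fun j : Fin n => x j)), Multiset.map_map]
    rfl
  rw [circulantSpectralMeasure, empiricalSpectralMeasure, charpoly_circulantRow, h,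
    Multiset.map_map]
  rfl

lemma isProbabilityMeasure_circulantSpectralMeasure (n : ℕ) [NeZero n] (x : ℕ → ℂ) :
    IsProbabilityMeasure (circulantSpectralMeasure n x) := by
  constructor
  rw [circulantSpectralMeasure_eq]
  simp [ENNReal.inv_mul_cancel (Nat.cast_ne_zero.mpr (NeZero.ne n)) (ENNReal.natCast_ne_top n)]

lemma integral_circulantSpectralMeasure {E : Type*} [NormedAddCommGroup E] [NormedSpace ℝ E]
    [CompleteSpace E] (n : ℕ) [NeZero n] (x : ℕ → ℂ) (f : ℂ → E) :
    ∫ z, f z ∂(circulantSpectralMeasure n x) =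
      (n : ℝ)⁻¹ • ∑ k, f (normalizedDFT (fun j : Fin n => x j) k) := by
  rw [circulantSpectralMeasure_eq, integral_smul_measure,
    integral_finsetSum_measure fun k _ => integrable_dirac (by simp)]
  simp

lemma sum_unitRoot_pow_sq_eq_zero {n : ℕ} [NeZero n] {k : ℕ} (hk : ¬ n ∣ 2 * k) :
    ∑ j : Fin n, (unitRoot n ^ ((j : ℕ) * k)) ^ 2 = 0 := by
  have h : ∀ j : Fin n, (unitRoot n ^ ((j : ℕ) * k)) ^ 2 = (unitRoot n ^ (2 * k)) ^ (j : ℕ) := by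
    intro j
    rw [← pow_mul, ← pow_mul]
    congr 1
    ring
  simp only [h]
  rw [Fin.sum_univ_eq_sum_range fun j => (unitRoot n ^ (2 * k)) ^ j,
    geom_sum_eq (fun h => hk ((isPrimitiveRoot_unitRoot n).pow_eq_one_iff_dvd _ |>.mp h)),
    ← pow_mul, mul_comm (2 * k), pow_mul, unitRoot_pow_self]
  simp

/-! ### The Efron–Stein inequality and fourth moments -/

lemma integrable_of_measurable_of_abs_le {S : Type*} [MeasurableSpace S] {μ : Measure S}
    [IsFiniteMeasure μ] {f : S → ℝ} (hf : Measurable f) {B : ℝ} (hb : ∀ x, |f x| ≤ B) :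
    Integrable f μ :=
  Integrable.of_bound hf.aestronglyMeasurable B (Eventually.of_forall hb)

lemma abs_integral_le_of_abs_le {S : Type*} [MeasurableSpace S] {μ : Measure S}
    [IsProbabilityMeasure μ] {f : S → ℝ} {B : ℝ} (hb : ∀ x, |f x| ≤ B) :
    |∫ x, f x ∂μ| ≤ B := by
  simpa using norm_integral_le_of_norm_le_const (μ := μ) (f := f) (Eventually.of_forall hb)

/-- The bias–variance decomposition. -/
lemma integral_sub_const_sq {S : Type*} [MeasurableSpace S] {μ : Measure S}
    [IsProbabilityMeasure μ] {f : S → ℝ} (hf : Measurable f) {B : ℝ} (hb : ∀ x, |f x| ≤ B)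
    (c : ℝ) :
    ∫ x, (f x - c) ^ 2 ∂μ = ∫ x, f x ^ 2 ∂μ - (∫ x, f x ∂μ) ^ 2 + (∫ x, f x ∂μ - c) ^ 2 := by
  have h1 : Integrable f μ := integrable_of_measurable_of_abs_le hf hb
  have h2 : Integrable (fun x => f x ^ 2) μ :=
    integrable_of_measurable_of_abs_le (B := B ^ 2) (hf.pow_const 2)
      fun x => by rw [abs_pow]; exact pow_le_pow_left₀ (abs_nonneg _) (hb x) 2
  have h3 : ∀ x, (f x - c) ^ 2 = f x ^ 2 - 2 * c * f x + c ^ 2 := fun x => by ring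
  simp only [h3]
  rw [integral_add (f := fun x => f x ^ 2 - 2 * c * f x) (h2.sub (h1.const_mul _))
    (integrable_const _), integral_sub h2 (h1.const_mul _), integral_const_mul]
  simp
  ring

lemma sq_integral_le_integral_sq {S : Type*} [MeasurableSpace S] {μ : Measure S}
    [IsProbabilityMeasure μ] {f : S → ℝ} (hf : Measurable f) {B : ℝ} (hb : ∀ x, |f x| ≤ B) :
    (∫ x, f x ∂μ) ^ 2 ≤ ∫ x, f x ^ 2 ∂μ := by
  have h := integral_sub_const_sq (μ := μ) hf hb (∫ x, f x ∂μ)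
  have h0 : 0 ≤ ∫ x, (f x - ∫ x, f x ∂μ) ^ 2 ∂μ := integral_nonneg fun x => sq_nonneg _
  rw [sub_self] at h
  nlinarith

lemma measurable_finCons {S : Type*} [MeasurableSpace S] {n : ℕ} :
    Measurable fun p : S × (Fin n → S) => (Fin.cons p.1 p.2 : Fin (n + 1) → S) := by
  refine measurable_pi_lambda _ fun i => ?_
  induction i using Fin.cases with
  | zero => simpa using measurable_fst
  | succ j => simpa using (measurable_pi_iff.mp measurable_snd j)

/-- Fubini's theorem for a product measure indexed by `Fin (n + 1)`, with the first coordinate in the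
inner integral. -/
lemma integral_pi_finSucc {S : Type*} [MeasurableSpace S] {n : ℕ} (μ : Fin (n + 1) → Measure S)
    [∀ i, IsProbabilityMeasure (μ i)] {H : (Fin (n + 1) → S) → ℝ} (hH : Measurable H) {B : ℝ}
    (hb : ∀ x, |H x| ≤ B) :
    ∫ x, H x ∂(Measure.pi μ) =
      ∫ y, ∫ x, H (Fin.cons x y) ∂(μ 0) ∂(Measure.pi fun j : Fin n => μ j.succ) := by
  have h := (measurePreserving_piFinSuccAbove μ 0).integral_comp
    (MeasurableEquiv.measurableEmbedding _)
    (fun p : S × (Fin n → S) => H (Fin.cons p.1 p.2))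
  have h2 : ∀ x : Fin (n + 1) → S,
      (Fin.cons (MeasurableEquiv.piFinSuccAbove (fun _ => S) 0 x).1
        (MeasurableEquiv.piFinSuccAbove (fun _ => S) 0 x).2 : Fin (n + 1) → S) = x := by
    intro x
    ext i
    induction i using Fin.cases <;> rfl
  simp only [h2] at h
  rw [h, integral_prod_symm]
  · rfl
  · exact integrable_of_measurable_of_abs_le (hH.comp measurable_finCons) fun p => hb _

lemma measurable_update_const {S : Type*} [MeasurableSpace S] {n : ℕ} (j : Fin n) (a : S) :
    Measurable fun x : Fin n → S => Function.update x j a := by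
  refine measurable_pi_lambda _ fun i => ?_
  by_cases h : i = j
  · subst h; simp
  · simpa [Function.update_of_ne h] using measurable_pi_apply i

lemma abs_sub_sq_le {u v B : ℝ} (hu : |u| ≤ B) (hv : |v| ≤ B) : |(u - v) ^ 2| ≤ 4 * B ^ 2 := by
  rw [abs_of_nonneg (sq_nonneg _)]
  rw [abs_le] at hu hv
  nlinarith

/-- The **Efron–Stein inequality**, in the form where each conditional variance is bounded by the mean
square distance to the value at a fixed point `a` of the corresponding coordinate. -/
theorem efron_stein {S : Type*} [MeasurableSpace S] (a : S) {n : ℕ} (μ : Fin n → Measure S)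
    [∀ i, IsProbabilityMeasure (μ i)] {F : (Fin n → S) → ℝ} (hF : Measurable F) {B : ℝ}
    (hb : ∀ x, |F x| ≤ B) :
    ∫ x, F x ^ 2 ∂(Measure.pi μ) - (∫ x, F x ∂(Measure.pi μ)) ^ 2 ≤
      ∑ j, ∫ x, (F x - F (Function.update x j a)) ^ 2 ∂(Measure.pi μ) := by
  induction n with
  | zero =>
    have hc : ∀ x, F x = F default := fun x => congrArg F (Subsingleton.elim _ _)
    simp [hc]
  | succ n ih =>
    set ν : Measure (Fin n → S) := Measure.pi fun j : Fin n => μ j.succ with hν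
    set g : (Fin n → S) → ℝ := fun y => ∫ x, F (Fin.cons x y) ∂(μ 0) with hg
    have hFc : Measurable fun p : S × (Fin n → S) => F (Fin.cons p.1 p.2) :=
      hF.comp measurable_finCons
    have hFx : ∀ y, Measurable fun x => F (Fin.cons x y) := fun y =>
      hFc.comp (measurable_id.prodMk measurable_const)
    have hgm : Measurable g := (hFc.stronglyMeasurable.integral_prod_left' (μ := μ 0)).measurable
    have hgb : ∀ y, |g y| ≤ B := fun y => abs_integral_le_of_abs_le fun x => hb _
    have hsqb : ∀ x, |F x ^ 2| ≤ B ^ 2 := fun x => by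
      rw [abs_pow]; exact pow_le_pow_left₀ (abs_nonneg _) (hb x) 2
    have hgsq : Integrable (fun y => g y ^ 2) ν :=
      integrable_of_measurable_of_abs_le (B := B ^ 2) (hgm.pow_const 2)
        fun y => by rw [abs_pow]; exact pow_le_pow_left₀ (abs_nonneg _) (hgb y) 2
    -- iterated integrals of bounded functions are integrable
    have hint : ∀ {H : (Fin (n + 1) → S) → ℝ} {C : ℝ}, Measurable H → (∀ x, |H x| ≤ C) →
        Integrable (fun y => ∫ x, H (Fin.cons x y) ∂(μ 0)) ν := fun {H C} hH hC =>
      integrable_of_measurable_of_abs_le (B := C)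
        ((hH.comp measurable_finCons).stronglyMeasurable.integral_prod_left' (μ := μ 0)).measurable
        fun y => abs_integral_le_of_abs_le fun x => hC _
    have hdm : ∀ j, Measurable fun x => (F x - F (Function.update x j a)) ^ 2 := fun j =>
      (hF.sub (hF.comp (measurable_update_const j a))).pow_const 2
    have hdb : ∀ j x, |(F x - F (Function.update x j a)) ^ 2| ≤ 4 * B ^ 2 := fun j x =>
      abs_sub_sq_le (hb _) (hb _)
    have h1 : ∫ x, F x ^ 2 ∂(Measure.pi μ) = ∫ y, ∫ x, F (Fin.cons x y) ^ 2 ∂(μ 0) ∂ν :=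
      integral_pi_finSucc μ (hF.pow_const 2) hsqb
    have h2 : ∫ x, F x ∂(Measure.pi μ) = ∫ y, g y ∂ν := integral_pi_finSucc μ hF hb
    have h3 : ∀ j, ∫ x, (F x - F (Function.update x j a)) ^ 2 ∂(Measure.pi μ) =
        ∫ y, ∫ x, (F (Fin.cons x y) - F (Function.update (Fin.cons x y) j a)) ^ 2 ∂(μ 0) ∂ν :=
      fun j => integral_pi_finSucc μ (hdm j) (hdb j)
    have hzero : ∫ y, ∫ x, F (Fin.cons x y) ^ 2 ∂(μ 0) ∂ν - ∫ y, g y ^ 2 ∂ν ≤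
        ∫ x, (F x - F (Function.update x 0 a)) ^ 2 ∂(Measure.pi μ) := by
      rw [h3, ← integral_sub (hint (hF.pow_const 2) hsqb) hgsq]
      refine integral_mono ((hint (hF.pow_const 2) hsqb).sub hgsq) (hint (hdm 0) (hdb 0))
        fun y => ?_
      simp only [Fin.update_cons_zero]
      rw [integral_sub_const_sq (hFx y) (fun x => hb _)]
      have := sq_nonneg (∫ x, F (Fin.cons x y) ∂(μ 0) - F (Fin.cons a y))
      simp only [hg]
      linarith
    have hsucc : ∀ j : Fin n, ∫ y, (g y - g (Function.update y j a)) ^ 2 ∂ν ≤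
        ∫ x, (F x - F (Function.update x j.succ a)) ^ 2 ∂(Measure.pi μ) := by
      intro j
      rw [h3]
      refine integral_mono (integrable_of_measurable_of_abs_le (B := 4 * B ^ 2)
        ((hgm.sub (hgm.comp (measurable_update_const j a))).pow_const 2)
        fun y => abs_sub_sq_le (hgb _) (hgb _)) (hint (hdm _) (hdb _)) fun y => ?_
      simp only [← Fin.cons_update, hg]
      rw [← integral_sub (integrable_of_measurable_of_abs_le (hFx _) fun x => hb _)
        (integrable_of_measurable_of_abs_le (hFx _) fun x => hb _)]
      refine sq_integral_le_integral_sq (B := 2 * B) ((hFx _).sub (hFx _)) fun x => ?_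
      have h4 := abs_sub (F (Fin.cons x y)) (F (Fin.cons x (Function.update y j a)))
      have h5 := hb (Fin.cons x y)
      have h6 := hb (Fin.cons x (Function.update y j a))
      linarith
    have hIH := ih (fun j => μ j.succ) hgm hgb
    rw [Fin.sum_univ_succ, h1, h2]
    have := Finset.sum_le_sum fun j (_ : j ∈ Finset.univ) => hsucc j
    linarith

/-- A pointwise bound `V` on the sum of the squared increments bounds the fourth central moment by
`11 V²`: Efron–Stein for `F` gives variance at most `V`, and Efron–Stein for `(F - E F)²` bounds the
variance of the latter. -/
theorem integral_sub_integral_pow_four_le {S : Type*} [MeasurableSpace S] (a : S) {n : ℕ}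
    (μ : Fin n → Measure S) [∀ i, IsProbabilityMeasure (μ i)] {F : (Fin n → S) → ℝ}
    (hF : Measurable F) {B : ℝ} (hb : ∀ x, |F x| ≤ B) {V : ℝ}
    (hV : ∀ x, ∑ j, (F x - F (Function.update x j a)) ^ 2 ≤ V) :
    ∫ x, (F x - ∫ y, F y ∂(Measure.pi μ)) ^ 4 ∂(Measure.pi μ) ≤ 11 * V ^ 2 := by
  set m : ℝ := ∫ y, F y ∂(Measure.pi μ) with hm
  have hmb : |m| ≤ B := abs_integral_le_of_abs_le hb
  set G : (Fin n → S) → ℝ := fun x => (F x - m) ^ 2 with hG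
  have hGm : Measurable G := (hF.sub_const m).pow_const 2
  have hGb : ∀ x, |G x| ≤ 4 * B ^ 2 := fun x => abs_sub_sq_le (hb x) hmb
  have hV0 : 0 ≤ V := by
    obtain ⟨x⟩ : Nonempty (Fin n → S) := ⟨fun _ => a⟩
    exact (Finset.sum_nonneg fun j _ => sq_nonneg _).trans (hV x)
  have hdm : ∀ j, Measurable fun x => F x - F (Function.update x j a) := fun j =>
    hF.sub (hF.comp (measurable_update_const j a))
  have hdi : ∀ j, Integrable (fun x => (F x - F (Function.update x j a)) ^ 2) (Measure.pi μ) :=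
    fun j => integrable_of_measurable_of_abs_le ((hdm j).pow_const 2)
      fun x => abs_sub_sq_le (hb _) (hb _)
  have hGdi : ∀ j, Integrable (fun x => (G x - G (Function.update x j a)) ^ 2) (Measure.pi μ) :=
    fun j => integrable_of_measurable_of_abs_le
      ((hGm.sub (hGm.comp (measurable_update_const j a))).pow_const 2)
      fun x => abs_sub_sq_le (hGb _) (hGb _)
  have hGi : Integrable G (Measure.pi μ) := integrable_of_measurable_of_abs_le hGm hGb
  -- the variance bound
  have hvar : ∫ x, G x ∂(Measure.pi μ) ≤ V := by
    have h1 := integral_sub_const_sq (μ := Measure.pi μ) hF hb m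
    have h2 := efron_stein a μ hF hb
    rw [← integral_finsetSum _ fun j _ => hdi j] at h2
    have h3 : ∫ x, ∑ j, (F x - F (Function.update x j a)) ^ 2 ∂(Measure.pi μ) ≤ V := by
      refine (integral_mono (integrable_finsetSum _ fun j _ => hdi j)
        (integrable_const V) hV).trans_eq (by simp)
    rw [← hm, sub_self] at h1
    rw [← hm] at h2
    simp only [hG]
    linarith
  -- apply the same inequality to the square of the centred function
  have h4 := efron_stein a μ hGm hGb
  rw [← integral_finsetSum _ fun j _ => hGdi j] at h4
  have h5 : ∀ x, ∑ j, (G x - G (Function.update x j a)) ^ 2 ≤ 8 * V * G x + 2 * V ^ 2 := by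
    intro x
    set d : Fin n → ℝ := fun j => F x - F (Function.update x j a) with hd
    have hterm : ∀ j, (G x - G (Function.update x j a)) ^ 2 ≤
        8 * G x * d j ^ 2 + 2 * V * d j ^ 2 := by
      intro j
      have e1 : G x - G (Function.update x j a) = d j * (2 * (F x - m) - d j) := by
        simp only [hG, hd]; ring
      have e2 : d j ^ 2 ≤ V := (Finset.single_le_sum (f := fun j => d j ^ 2)
        (fun i _ => sq_nonneg _) (Finset.mem_univ j)).trans (hV x)
      have e3 : (2 * (F x - m) - d j) ^ 2 ≤ 8 * G x + 2 * V := by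
        simp only [hG]
        nlinarith [sq_nonneg (2 * (F x - m) + d j)]
      rw [e1, mul_pow]
      nlinarith [mul_le_mul_of_nonneg_left e3 (sq_nonneg (d j))]
    have hx := hV x
    have hG0 : 0 ≤ G x := sq_nonneg _
    calc ∑ j, (G x - G (Function.update x j a)) ^ 2
        ≤ ∑ j, (8 * G x * d j ^ 2 + 2 * V * d j ^ 2) := Finset.sum_le_sum fun j _ => hterm j
      _ = (8 * G x + 2 * V) * ∑ j, d j ^ 2 := by
          rw [Finset.mul_sum]; exact Finset.sum_congr rfl fun j _ => by ring
      _ ≤ (8 * G x + 2 * V) * V := mul_le_mul_of_nonneg_left hx (by positivity)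
      _ = 8 * V * G x + 2 * V ^ 2 := by ring
  have h6 : ∫ x, ∑ j, (G x - G (Function.update x j a)) ^ 2 ∂(Measure.pi μ) ≤
      8 * V * ∫ x, G x ∂(Measure.pi μ) + 2 * V ^ 2 := by
    refine (integral_mono (integrable_finsetSum _ fun j _ => hGdi j)
      ((hGi.const_mul _).add (integrable_const _)) h5).trans_eq ?_
    simp only [Pi.add_apply]
    rw [integral_add (hGi.const_mul _) (integrable_const _), integral_const_mul]
    simp
  have h7 : 0 ≤ ∫ x, G x ∂(Measure.pi μ) := integral_nonneg fun x => sq_nonneg _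
  have h8 : ∀ x, (F x - m) ^ 4 = G x ^ 2 := fun x => by simp only [hG]; ring
  simp only [h8]
  nlinarith

/-! ### Tail and moment bounds -/

lemma klDiv_cond_self {S : Type*} [MeasurableSpace S] (μ : Measure S) [IsProbabilityMeasure μ]
    {B : Set S} (hB : MeasurableSet B) (h0 : μ B ≠ 0) :
    InformationTheory.klDiv (μ[|B]) μ = ENNReal.ofReal (-Real.log (μ.real B)) := by
  have hprob : IsProbabilityMeasure (μ[|B]) := cond_isProbabilityMeasure h0
  have hac : μ[|B] ≪ μ := cond_absolutelyContinuous
  have hinv : (μ B)⁻¹ ≠ ∞ := ENNReal.inv_ne_top.mpr h0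
  have hd : (μ[|B]).rnDeriv μ =ᵐ[μ] (μ B)⁻¹ • B.indicator 1 := by
    rw [ProbabilityTheory.cond]
    refine (Measure.rnDeriv_smul_left_of_ne_top _ _ hinv).trans ?_
    filter_upwards [Measure.rnDeriv_restrict_self μ hB] with x hx
    simp [hx]
  have hllr : llr (μ[|B]) μ =ᵐ[μ[|B]] fun _ => -Real.log (μ.real B) := by
    filter_upwards [hac.ae_le hd, ae_cond_mem hB] with x hx hxB
    rw [llr, hx]
    simp [hxB, Measure.real, Real.log_inv]
  rw [InformationTheory.klDiv_of_ac_of_integrable hac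
    ((integrable_congr hllr).mpr (integrable_const _)), integral_congr_ae hllr]
  simp

/-- A coupling of `μ` with a measure carried by `B` moves the mass `μ A` by at least the distance from
`A` to `B`. -/
lemma le_quadraticCost {μ ν : Measure ℂ} [IsProbabilityMeasure μ] {A B : Set ℂ}
    (hA : MeasurableSet A) (hB : MeasurableSet B) (hνB : ν Bᶜ = 0) {s : ℝ} (hs : 0 ≤ s)
    (hdist : ∀ x ∈ A, ∀ y ∈ B, s ≤ ‖x - y‖) :
    ENNReal.ofReal (s ^ 2) * μ A ≤ quadraticCost μ ν := by
  refine le_iInf₂ fun π hπ => ?_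
  obtain ⟨h1, h2⟩ := hπ
  have hm : MeasurableSet (Prod.fst ⁻¹' A ∩ Prod.snd ⁻¹' B : Set (ℂ × ℂ)) :=
    (measurable_fst hA).inter (measurable_snd hB)
  have hπ : π (Prod.fst ⁻¹' A ∩ Prod.snd ⁻¹' B) = μ A := by
    rw [measure_inter_conull, ← Measure.map_apply measurable_fst hA, h1]
    rw [← h2, Measure.map_apply measurable_snd hB.compl] at hνB
    exact hνB
  calc ENNReal.ofReal (s ^ 2) * μ A
      = ∫⁻ p in (Prod.fst ⁻¹' A ∩ Prod.snd ⁻¹' B : Set (ℂ × ℂ)), ENNReal.ofReal (s ^ 2) ∂π := by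
        rw [setLIntegral_const, hπ]
    _ ≤ ∫⁻ p in (Prod.fst ⁻¹' A ∩ Prod.snd ⁻¹' B : Set (ℂ × ℂ)),
          ENNReal.ofReal (‖p.1 - p.2‖ ^ 2) ∂π := by
        refine setLIntegral_mono' hm fun p hp => ENNReal.ofReal_le_ofReal ?_
        exact pow_le_pow_left₀ hs (hdist _ hp.1 _ hp.2) 2
    _ ≤ _ := setLIntegral_le_lintegral _ _

/-- Marton's argument: either transportation inequality forces at least exponential tails. -/
lemma measureReal_le_exp_of_transport {μ : Measure ℂ} [IsProbabilityMeasure μ] {K : ℝ}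
    (hK : 0 < K)
    (h : QuadraticTransportInequality μ K ∨ QuadraticTransportInequality' μ K)
    (hA : 3 / 4 ≤ μ.real {z | ‖z‖ < 2}) {s : ℝ} (hs : 0 ≤ s) :
    μ.real {z | 2 + s ≤ ‖z‖} ≤ Real.exp (-(s - 5 / 2) / (2 * K)) := by
  set A : Set ℂ := {z | ‖z‖ < 2}
  set B : Set ℂ := {z | 2 + s ≤ ‖z‖}
  have hAm : MeasurableSet A := measurableSet_lt measurable_norm measurable_const
  have hBm : MeasurableSet B := measurableSet_le measurable_const measurable_norm
  by_cases h0 : μ B = 0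
  · rw [Measure.real, h0]
    exact (Real.exp_pos _).le
  have hprob : IsProbabilityMeasure (μ[|B]) := cond_isProbabilityMeasure h0
  have hp0 : 0 < μ.real B := ENNReal.toReal_pos h0 (measure_ne_top _ _)
  have hνB : μ[|B] Bᶜ = 0 := ae_cond_mem hBm
  have hdist : ∀ x ∈ A, ∀ y ∈ B, s ≤ ‖x - y‖ := by
    intro x hx y hy
    have h1 := norm_sub_norm_le y x
    rw [norm_sub_rev] at h1
    simp only [A, B, Set.mem_ofPred_eq] at hx hy
    linarith
  have hcost := le_quadraticCost (μ := μ) hAm hBm hνB hs hdist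
  have hx : ENNReal.ofReal (3 / 4 * s ^ 2) ≤ quadraticCost μ (μ[|B]) := by
    refine le_trans ?_ hcost
    rw [← ofReal_measureReal, ← ENNReal.ofReal_mul (sq_nonneg s)]
    exact ENNReal.ofReal_le_ofReal (by nlinarith [sq_nonneg s])
  set L : ℝ := -Real.log (μ.real B) with hL
  have hL0 : 0 ≤ L := neg_nonneg.mpr (Real.log_nonpos hp0.le measureReal_le_one)
  have hkl : ENNReal.ofReal (2 * K) * InformationTheory.klDiv (μ[|B]) μ =
      ENNReal.ofReal (2 * K * L) := by
    rw [klDiv_cond_self μ hBm h0, ← ENNReal.ofReal_mul (by positivity)]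
  -- a linear lower bound for the cost that is weak enough to hold in both cases
  have hmain : s - 5 / 2 ≤ 2 * K * L := by
    rcases h with h | h
    · have h1 := h (μ[|B]) hprob
      rw [hkl, ENNReal.rpow_le_rpow_iff (by norm_num)] at h1
      have h2 := (ENNReal.ofReal_le_ofReal_iff (by positivity)).mp (hx.trans h1)
      nlinarith [sq_nonneg (s - 1)]
    · have h1 := hx.trans (h (μ[|B]) hprob)
      rw [hkl, ENNReal.ofReal_rpow_of_nonneg (by positivity) (by norm_num),
        ENNReal.ofReal_le_ofReal_iff (by positivity), ← Real.sqrt_eq_rpow] at h1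
      have h2 : (3 / 4 * s ^ 2) ^ 2 ≤ 2 * K * L :=
        (Real.le_sqrt (by positivity) (by positivity)).mp h1
      nlinarith [sq_nonneg (s - 1), sq_nonneg (3 / 4 * s ^ 2 - 1)]
  rw [← Real.log_le_iff_le_exp hp0, neg_div]
  have : (s - 5 / 2) / (2 * K) ≤ L := by
    rw [div_le_iff₀ (by positivity)]
    linarith
  linarith

lemma integrable_norm_sq_of_integral_eq_one {Ω : Type*} [MeasurableSpace Ω] {P : Measure Ω}
    {Y : Ω → ℂ} (h : ∫ ω, ‖Y ω‖ ^ 2 ∂P = 1) : Integrable (fun ω => ‖Y ω‖ ^ 2) P := by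
  by_contra hn
  rw [integral_undef hn] at h
  exact zero_ne_one h

lemma three_quarters_le_measureReal {Ω : Type*} [MeasurableSpace Ω] {P : Measure Ω}
    [IsProbabilityMeasure P] {Y : Ω → ℂ} (hY : Measurable Y)
    (h : ∫ ω, ‖Y ω‖ ^ 2 ∂P = 1) : 3 / 4 ≤ P.real {ω | ‖Y ω‖ < 2} := by
  have hi : Integrable (fun ω => ‖Y ω‖ ^ 2) P := integrable_norm_sq_of_integral_eq_one h
  have h1 := mul_meas_ge_le_integral_of_nonneg (Eventually.of_forall fun ω => sq_nonneg ‖Y ω‖)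
    hi 4
  rw [h] at h1
  have h2 : {ω | ‖Y ω‖ < 2}ᶜ = {ω | 4 ≤ ‖Y ω‖ ^ 2} := by
    ext ω
    simp only [Set.mem_compl_iff, Set.mem_ofPred_eq, not_lt]
    constructor
    · intro h; nlinarith
    · intro h; nlinarith [norm_nonneg (Y ω)]
  have h3 := probReal_compl_eq_one_sub (μ := P)
    (measurableSet_lt hY.norm (measurable_const (a := (2 : ℝ))))
  rw [h2] at h3
  linarith

/-- Each of the three alternatives yields a polynomial tail bound that is uniform in `j`. The exponent
`48` is what the truncation at level `n^{1/16}` needs to have summable error probabilities. -/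
lemma exists_uniform_tail {Ω : Type*} [MeasurableSpace Ω] (P : Measure Ω)
    [IsProbabilityMeasure P] (X : ℕ → Ω → ℂ) (hmeas : ∀ j, Measurable (X j))
    (habs : ∀ j, ∫ ω, ‖X j ω‖ ^ 2 ∂P = 1)
    (h : (∃ K : ℝ, 0 < K ∧ ∀ j, ∀ᵐ ω ∂P, ‖X j ω‖ ≤ K) ∨
      (∃ K : ℝ, 0 < K ∧ ∀ j, QuadraticTransportInequality (P.map (X j)) K) ∨
      (∃ K : ℝ, 0 < K ∧ ∀ j, QuadraticTransportInequality' (P.map (X j)) K)) :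
    ∃ C : ℝ, ∀ j s, 0 ≤ s → P.real {ω | s ≤ ‖X j ω‖} ≤ C / (1 + s) ^ 48 := by
  have htransport : ∀ K : ℝ, 0 < K → (∀ j, QuadraticTransportInequality (P.map (X j)) K ∨
      QuadraticTransportInequality' (P.map (X j)) K) →
      ∃ C : ℝ, ∀ j s, 0 ≤ s → P.real {ω | s ≤ ‖X j ω‖} ≤ C / (1 + s) ^ 48 := by
    intro K hK hT
    set D : ℝ := Real.exp (11 / (4 * K)) * (Nat.factorial 48 * (2 * K) ^ 48) with hD
    -- the summand `3 ^ 48` covers the range `s < 2`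
    refine ⟨3 ^ 48 + D, fun j s hs => ?_⟩
    have hpos : 0 < (1 + s) ^ 48 := by positivity
    rw [le_div_iff₀ hpos]
    have hD0 : 0 ≤ D := by positivity
    rcases lt_or_ge s 2 with hs2 | hs2
    · have h1 : P.real {ω | s ≤ ‖X j ω‖} * (1 + s) ^ 48 ≤ 1 * 3 ^ 48 :=
        mul_le_mul measureReal_le_one (pow_le_pow_left₀ (by linarith) (by linarith) 48)
          hpos.le zero_le_one
      linarith
    · have hprob : IsProbabilityMeasure (P.map (X j)) :=
        Measure.isProbabilityMeasure_map (hmeas j).aemeasurable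
      have hq : 3 / 4 ≤ (P.map (X j)).real {z | ‖z‖ < 2} := by
        rw [map_measureReal_apply (hmeas j) (measurableSet_lt measurable_norm measurable_const)]
        exact three_quarters_le_measureReal (hmeas j) (habs j)
      have h1 := measureReal_le_exp_of_transport hK (hT j) hq (sub_nonneg.mpr hs2)
      rw [map_measureReal_apply (hmeas j) (measurableSet_le measurable_const measurable_norm),
        add_sub_cancel] at h1
      have h2 : Real.exp (-(s - 2 - 5 / 2) / (2 * K)) =
          Real.exp (11 / (4 * K)) / Real.exp ((1 + s) / (2 * K)) := by
        rw [← Real.exp_sub]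
        congr 1
        field_simp
        ring
      have h3 := Real.pow_div_factorial_le_exp ((1 + s) / (2 * K)) (by positivity) 48
      have h4 : (1 + s) ^ 48 ≤
          Nat.factorial 48 * (2 * K) ^ 48 * Real.exp ((1 + s) / (2 * K)) := by
        rw [div_pow, div_div, div_le_iff₀ (by positivity)] at h3
        linarith
      have h5 : Real.exp (11 / (4 * K)) / Real.exp ((1 + s) / (2 * K)) * (1 + s) ^ 48 ≤ D := by
        rw [hD, div_mul_eq_mul_div, div_le_iff₀ (Real.exp_pos _), mul_assoc]
        exact mul_le_mul_of_nonneg_left h4 (Real.exp_pos _).le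
      have h6 : P.real {ω | s ≤ ‖X j ω‖} * (1 + s) ^ 48 ≤ D :=
        (mul_le_mul_of_nonneg_right (h1.trans_eq h2) hpos.le).trans h5
      have : (0 : ℝ) ≤ 3 ^ 48 := by positivity
      linarith
  rcases h with ⟨K, hK, h⟩ | ⟨K, hK, h⟩ | ⟨K, hK, h⟩
  · refine ⟨(1 + K) ^ 48, fun j s hs => ?_⟩
    rcases lt_or_ge K s with hKs | hKs
    · have h0 : P {ω | s ≤ ‖X j ω‖} = 0 :=
        measure_mono_null (fun ω hω => not_le.mpr (hKs.trans_le hω)) (h j)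
      rw [Measure.real, h0]
      simp only [ENNReal.toReal_zero]
      positivity
    · refine measureReal_le_one.trans ?_
      rw [one_le_div₀ (by positivity)]
      exact pow_le_pow_left₀ (by linarith) (by linarith) 48
  · exact htransport K hK fun j => Or.inl (h j)
  · exact htransport K hK fun j => Or.inr (h j)

lemma exists_third_moment_bound {Ω : Type*} [MeasurableSpace Ω] (P : Measure Ω)
    [IsProbabilityMeasure P] (X : ℕ → Ω → ℂ) (hmeas : ∀ j, Measurable (X j)) {C : ℝ}
    (hC : ∀ j s, 0 ≤ s → P.real {ω | s ≤ ‖X j ω‖} ≤ C / (1 + s) ^ 48) :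
    ∃ M : ℝ, 0 ≤ M ∧ ∀ j, Integrable (fun ω => ‖X j ω‖ ^ 3) P ∧ ∫ ω, ‖X j ω‖ ^ 3 ∂P ≤ M := by
  have hC0 : 0 ≤ C := by simpa using measureReal_nonneg.trans (hC 0 0 le_rfl)
  have hsum : Summable fun m : ℕ => C * (1 / (m + 1 : ℝ) ^ 2) := by
    have := (summable_nat_add_iff 1).mpr (Real.summable_one_div_nat_pow.mpr (by norm_num : 1 < 2))
    exact Summable.mul_left C (by simpa using this)
  have hbound : ∀ j, ∫⁻ ω, ENNReal.ofReal (‖X j ω‖ ^ 3) ∂P ≤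
      ENNReal.ofReal (∑' m : ℕ, C * (1 / (m + 1 : ℝ) ^ 2)) := by
    intro j
    have hset : ∀ m : ℕ, MeasurableSet {ω | (m : ℝ) ≤ ‖X j ω‖} := fun m =>
      measurableSet_le measurable_const (hmeas j).norm
    have hpt : ∀ ω, ENNReal.ofReal (‖X j ω‖ ^ 3) ≤ ∑' m : ℕ,
        {ω | (m : ℝ) ≤ ‖X j ω‖}.indicator (fun _ => ENNReal.ofReal ((m + 1 : ℝ) ^ 3)) ω := by
      intro ω
      -- the single term with `m = ⌊‖X j ω‖⌋` already dominates
      refine le_trans ?_ (ENNReal.le_tsum ⌊‖X j ω‖⌋₊)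
      rw [Set.indicator_of_mem (by exact Nat.floor_le (norm_nonneg _))]
      exact ENNReal.ofReal_le_ofReal
        (pow_le_pow_left₀ (norm_nonneg _) (Nat.lt_floor_add_one _).le 3)
    calc ∫⁻ ω, ENNReal.ofReal (‖X j ω‖ ^ 3) ∂P
        ≤ ∫⁻ ω, ∑' m : ℕ, {ω | (m : ℝ) ≤ ‖X j ω‖}.indicator
            (fun _ => ENNReal.ofReal ((m + 1 : ℝ) ^ 3)) ω ∂P := lintegral_mono hpt
      _ = ∑' m : ℕ, ENNReal.ofReal ((m + 1 : ℝ) ^ 3) * P {ω | (m : ℝ) ≤ ‖X j ω‖} := by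
          rw [lintegral_tsum fun m => (measurable_const.indicator (hset m)).aemeasurable]
          exact tsum_congr fun m => lintegral_indicator_const (hset m) _
      _ ≤ ∑' m : ℕ, ENNReal.ofReal (C * (1 / (m + 1 : ℝ) ^ 2)) := by
          refine ENNReal.tsum_le_tsum fun m => ?_
          rw [← ofReal_measureReal, ← ENNReal.ofReal_mul (by positivity)]
          refine ENNReal.ofReal_le_ofReal ?_
          have h1 := hC j m (Nat.cast_nonneg m)
          have hm : (1 : ℝ) ≤ m + 1 := by linarith [Nat.cast_nonneg (α := ℝ) m]
          have h2 : C / (1 + m : ℝ) ^ 48 ≤ C / (1 + m : ℝ) ^ 5 :=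
            div_le_div_of_nonneg_left hC0 (by positivity)
              (pow_le_pow_right₀ (by linarith) (by norm_num))
          calc (m + 1 : ℝ) ^ 3 * P.real {ω | (m : ℝ) ≤ ‖X j ω‖}
              ≤ (m + 1 : ℝ) ^ 3 * (C / (1 + m : ℝ) ^ 5) :=
                mul_le_mul_of_nonneg_left (h1.trans h2) (by positivity)
            _ = C * (1 / (m + 1 : ℝ) ^ 2) := by
                rw [add_comm (1 : ℝ)]
                field_simp
      _ = _ := (ENNReal.ofReal_tsum_of_nonneg (fun m => by positivity) hsum).symm
  refine ⟨∑' m : ℕ, C * (1 / (m + 1 : ℝ) ^ 2), tsum_nonneg fun m => by positivity, fun j => ?_⟩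
  have hnn : 0 ≤ᵐ[P] fun ω => ‖X j ω‖ ^ 3 := Eventually.of_forall fun ω => by positivity
  have hm3 : AEStronglyMeasurable (fun ω => ‖X j ω‖ ^ 3) P :=
    ((hmeas j).norm.pow_const 3).aestronglyMeasurable
  refine ⟨?_, ?_⟩
  · exact (lintegral_ofReal_ne_top_iff_integrable hm3 hnn).mp
      ((hbound j).trans_lt ENNReal.ofReal_lt_top).ne
  · rw [integral_eq_lintegral_of_nonneg_ae hnn hm3]
    exact ENNReal.toReal_le_of_le_ofReal (tsum_nonneg fun m => by positivity) (hbound j)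

/-! ### Almost sure concentration by truncation -/

/-- The truncation that replaces `z` by `0` when `‖z‖ > K`. -/
noncomputable def truncate (K : ℝ) (z : ℂ) : ℂ := if ‖z‖ ≤ K then z else 0

lemma measurable_truncate (K : ℝ) : Measurable (truncate K) :=
  Measurable.ite (measurableSet_le measurable_norm measurable_const) measurable_id measurable_const

lemma norm_truncate_le {K : ℝ} (hK : 0 ≤ K) (z : ℂ) : ‖truncate K z‖ ≤ K := by
  unfold truncate
  split_ifs with h
  · exact h
  · simpa using hK

lemma norm_truncate_le_norm (K : ℝ) (z : ℂ) : ‖truncate K z‖ ≤ ‖z‖ := by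
  unfold truncate
  split_ifs with h <;> simp

lemma truncate_zero (K : ℝ) : truncate K 0 = 0 := by simp [truncate]

lemma truncate_comp_update {n : ℕ} (K : ℝ) (x : Fin n → ℂ) (j : Fin n) :
    (fun i => truncate K (Function.update x j 0 i)) =
      Function.update (fun i => truncate K (x i)) j 0 := by
  ext i
  by_cases h : i = j
  · subst h; simp [truncate_zero]
  · simp [Function.update_of_ne h]

/-- The truncation level `n^{1/16}` for the first `n` variables: it grows fast enough that truncation
is almost surely void for large `n`, and slowly enough that fourth moments stay summable. -/
noncomputable def truncLevel (n : ℕ) : ℝ := (n : ℝ) ^ (1 / 16 : ℝ)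

lemma truncLevel_nonneg (n : ℕ) : 0 ≤ truncLevel n := Real.rpow_nonneg (Nat.cast_nonneg n) _

lemma one_le_truncLevel {n : ℕ} (hn : 1 ≤ n) : 1 ≤ truncLevel n :=
  Real.one_le_rpow (by exact_mod_cast hn) (by norm_num)

lemma truncLevel_pow_sixteen (n : ℕ) : truncLevel n ^ 16 = n := by
  rw [truncLevel, ← Real.rpow_natCast, ← Real.rpow_mul (Nat.cast_nonneg n)]
  norm_num

lemma truncLevel_pow_eight (n : ℕ) : truncLevel n ^ 8 = (n : ℝ) ^ (1 / 2 : ℝ) := by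
  rw [truncLevel, ← Real.rpow_natCast, ← Real.rpow_mul (Nat.cast_nonneg n)]
  norm_num

/-- By the Borel–Cantelli lemma, truncation almost surely has no effect for large `n`. -/
lemma ae_eventually_truncate_eq {Ω : Type*} [MeasurableSpace Ω] (P : Measure Ω)
    [IsProbabilityMeasure P] (X : ℕ → Ω → ℂ) {C : ℝ}
    (hC : ∀ j s, 0 ≤ s → P.real {ω | s ≤ ‖X j ω‖} ≤ C / (1 + s) ^ 48) :
    ∀ᵐ ω ∂P, ∀ᶠ n : ℕ in atTop, ∀ j < n, truncate (truncLevel n) (X j ω) = X j ω := by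
  have hC0 : 0 ≤ C := by simpa using measureReal_nonneg.trans (hC 0 0 le_rfl)
  have hle : ∀ n : ℕ, P (⋃ j ∈ Finset.range n, {ω | truncLevel n ≤ ‖X j ω‖}) ≤
      ENNReal.ofReal (C * (1 / (n : ℝ) ^ 2)) := by
    intro n
    rcases Nat.eq_zero_or_pos n with rfl | hn
    · simp
    have hn0 : (0 : ℝ) < n := by exact_mod_cast hn
    have hK := one_le_truncLevel hn
    have hK48 : truncLevel n ^ 48 = (n : ℝ) ^ 3 := by
      rw [← truncLevel_pow_sixteen n, ← pow_mul]
    calc P (⋃ j ∈ Finset.range n, {ω | truncLevel n ≤ ‖X j ω‖})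
        ≤ ∑ j ∈ Finset.range n, P {ω | truncLevel n ≤ ‖X j ω‖} := measure_biUnion_finset_le _ _
      _ ≤ ∑ j ∈ Finset.range n, ENNReal.ofReal (C / (n : ℝ) ^ 3) := by
          refine Finset.sum_le_sum fun j _ => ?_
          rw [← ofReal_measureReal]
          refine ENNReal.ofReal_le_ofReal ((hC j _ (truncLevel_nonneg n)).trans ?_)
          rw [← hK48]
          exact div_le_div_of_nonneg_left hC0 (by positivity)
            (pow_le_pow_left₀ (by linarith) (by linarith) 48)
      _ = ENNReal.ofReal (C * (1 / (n : ℝ) ^ 2)) := by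
          rw [Finset.sum_const, Finset.card_range, nsmul_eq_mul, ← ENNReal.ofReal_natCast,
            ← ENNReal.ofReal_mul hn0.le]
          congr 1
          field_simp
  have hsum : ∑' n : ℕ, P (⋃ j ∈ Finset.range n, {ω | truncLevel n ≤ ‖X j ω‖}) ≠ ∞ := by
    refine ne_top_of_le_ne_top ?_ (ENNReal.tsum_le_tsum hle)
    exact ((Real.summable_one_div_nat_pow.mpr (by norm_num)).mul_left C).tsum_ofReal_ne_top
  filter_upwards [ae_eventually_notMem hsum] with ω hω
  filter_upwards [hω] with n hn j hj
  simp only [Set.mem_iUnion, not_exists, Finset.mem_range] at hn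
  have := hn j hj
  simp only [Set.mem_ofPred_eq, not_le] at this
  simp [truncate, this.le]

lemma ae_tendsto_zero_of_summable_fourth_moment {Ω : Type*} [MeasurableSpace Ω] {P : Measure Ω}
    {Z : ℕ → Ω → ℝ} (hZ : ∀ n, Measurable (Z n))
    (hi : ∀ n, Integrable (fun ω => Z n ω ^ 4) P) {c : ℕ → ℝ} (hc : Summable c)
    (h : ∀ n, ∫ ω, Z n ω ^ 4 ∂P ≤ c n) :
    ∀ᵐ ω ∂P, Tendsto (fun n => Z n ω) atTop (𝓝 0) := by
  have hm : ∀ n, Measurable fun ω => ENNReal.ofReal (Z n ω ^ 4) := fun n =>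
    ((hZ n).pow_const 4).ennreal_ofReal
  have hfin : ∫⁻ ω, ∑' n, ENNReal.ofReal (Z n ω ^ 4) ∂P ≠ ∞ := by
    rw [lintegral_tsum fun n => (hm n).aemeasurable]
    refine ne_top_of_le_ne_top hc.tsum_ofReal_ne_top (ENNReal.tsum_le_tsum fun n => ?_)
    rw [← ofReal_integral_eq_lintegral_ofReal (hi n)
      (Eventually.of_forall fun ω => by positivity)]
    exact ENNReal.ofReal_le_ofReal (h n)
  filter_upwards [ae_lt_top (Measurable.tsum hm) hfin] with ω hω
  have h1 := ENNReal.tendsto_atTop_zero_of_tsum_ne_top hω.ne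
  have h2 := (ENNReal.tendsto_toReal ENNReal.zero_ne_top).comp h1
  have h3 : Tendsto (fun n => Z n ω ^ 4) atTop (𝓝 0) := by
    refine (by simpa using h2 : Tendsto _ _ _).congr fun n => ?_
    simp only [Function.comp_apply]
    rw [ENNReal.toReal_ofReal (by positivity)]
  have h4 := (h3.sqrt).sqrt
  simp only [Real.sqrt_zero] at h4
  refine tendsto_zero_iff_abs_tendsto_zero _ |>.mpr (h4.congr fun n => ?_)
  have : Z n ω ^ 4 = (Z n ω ^ 2) ^ 2 := by ring
  rw [this, Real.sqrt_sq (sq_nonneg _), Real.sqrt_sq_eq_abs]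
  rfl

/-- Functions `F n` of the first `n` variables whose squared increments add up to `O(K⁴ / n)` on the
polydisc of radius `K` are almost surely asymptotic to the means of their truncated versions. -/
theorem ae_tendsto_sub_integral_truncate {Ω : Type*} [MeasurableSpace Ω] (P : Measure Ω)
    [IsProbabilityMeasure P] (X : ℕ → Ω → ℂ) (hmeas : ∀ j, Measurable (X j))
    (hindep : iIndepFun X P) {C : ℝ}
    (hC : ∀ j s, 0 ≤ s → P.real {ω | s ≤ ‖X j ω‖} ≤ C / (1 + s) ^ 48)
    {F : ∀ n : ℕ, (Fin n → ℂ) → ℝ} (hF : ∀ n, Measurable (F n)) {b : ℝ → ℝ}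
    (hb : ∀ n K, 0 ≤ K → ∀ y : Fin n → ℂ, (∀ j, ‖y j‖ ≤ K) → |F n y| ≤ b K) {A : ℝ}
    (hV : ∀ n K, 1 ≤ K → ∀ y : Fin n → ℂ, (∀ j, ‖y j‖ ≤ K) →
      ∑ j, (F n y - F n (Function.update y j 0)) ^ 2 ≤ A * K ^ 4 / n) :
    ∀ᵐ ω ∂P, Tendsto (fun n : ℕ => F n (fun j => X j ω) -
      ∫ ω', F n (fun j => truncate (truncLevel n) (X j ω')) ∂P) atTop (𝓝 0) := by
  set G : ∀ n : ℕ, (Fin n → ℂ) → ℝ := fun n x => F n fun j => truncate (truncLevel n) (x j) with hG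
  have hGm : ∀ n, Measurable (G n) := fun n => (hF n).comp
    (measurable_pi_lambda _ fun j => (measurable_truncate _).comp (measurable_pi_apply j))
  have hGb : ∀ n x, |G n x| ≤ b (truncLevel n) := fun n x =>
    hb n _ (truncLevel_nonneg n) _ fun j => norm_truncate_le (truncLevel_nonneg n) _
  have hXm : ∀ n : ℕ, Measurable fun ω => fun j : Fin n => X j ω := fun n =>
    measurable_pi_lambda _ fun j => hmeas j
  set m : ℕ → ℝ := fun n => ∫ ω, G n (fun j => X j ω) ∂P with hm
  have hZm : ∀ n, Measurable fun ω => G n (fun j => X j ω) - m n := fun n =>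
    ((hGm n).comp (hXm n)).sub_const _
  have hmb : ∀ n, |m n| ≤ b (truncLevel n) := fun n => abs_integral_le_of_abs_le fun ω => hGb n _
  have hconc : ∀ᵐ ω ∂P, Tendsto (fun n : ℕ => G n (fun j => X j ω) - m n) atTop (𝓝 0) := by
    have hs : Summable fun n : ℕ => 11 * A ^ 2 * (1 / (n : ℝ) ^ (3 / 2 : ℝ)) :=
      (Real.summable_one_div_nat_rpow.mpr (by norm_num)).mul_left _
    refine ae_tendsto_zero_of_summable_fourth_moment hZm (fun n => ?_) hs fun n => ?_
    · refine integrable_of_measurable_of_abs_le (B := (4 * b (truncLevel n) ^ 2) ^ 2)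
        ((hZm n).pow_const 4) fun ω => ?_
      have h1 := abs_sub_sq_le (hGb n fun j => X j ω) (hmb n)
      have h2 : (G n (fun j => X j ω) - m n) ^ 4 = ((G n (fun j => X j ω) - m n) ^ 2) ^ 2 := by
        ring
      rw [h2, abs_pow]
      exact pow_le_pow_left₀ (abs_nonneg _) h1 2
    · have hprob : ∀ j : Fin n, IsProbabilityMeasure (P.map (X j)) := fun j =>
        Measure.isProbabilityMeasure_map (hmeas j).aemeasurable
      have hmap : P.map (fun ω => fun j : Fin n => X j ω) =
          Measure.pi fun j : Fin n => P.map (X j) :=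
        (iIndepFun_iff_map_fun_eq_pi_map fun j : Fin n => (hmeas j).aemeasurable).mp
          (hindep.precomp Fin.val_injective)
      have hmeq : m n = ∫ x, G n x ∂(Measure.pi fun j : Fin n => P.map (X j)) := by
        rw [← hmap, integral_map (hXm n).aemeasurable (hGm n).aestronglyMeasurable]
      have hVG : ∀ x, ∑ j, (G n x - G n (Function.update x j 0)) ^ 2 ≤
          A * truncLevel n ^ 4 / n := by
        intro x
        rcases Nat.eq_zero_or_pos n with rfl | hn
        · simp
        simp only [hG, truncate_comp_update]
        exact hV n _ (one_le_truncLevel hn) _ fun j => norm_truncate_le (truncLevel_nonneg n) _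
      have h4 := integral_sub_integral_pow_four_le 0 (fun j : Fin n => P.map (X j)) (hGm n)
        (hGb n) hVG
      rw [← hmeq, ← hmap, integral_map (hXm n).aemeasurable
        (((hGm n).sub_const _).pow_const 4).aestronglyMeasurable] at h4
      refine h4.trans_eq ?_
      rcases Nat.eq_zero_or_pos n with rfl | hn
      · simp
      have hn0 : (0 : ℝ) < n := by exact_mod_cast hn
      have h8 : (A * truncLevel n ^ 4 / n) ^ 2 = A ^ 2 * (truncLevel n ^ 8 / (n : ℝ) ^ 2) := by
        ring
      have h32 : (n : ℝ) ^ (1 / 2 : ℝ) / (n : ℝ) ^ 2 = 1 / (n : ℝ) ^ (3 / 2 : ℝ) := by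
        rw [div_eq_div_iff (by positivity) (by positivity), one_mul, ← Real.rpow_natCast,
          ← Real.rpow_add hn0]
        norm_num
      rw [h8, truncLevel_pow_eight, h32]
      ring
  filter_upwards [hconc, ae_eventually_truncate_eq P X hC] with ω h1 h2
  refine h1.congr' ?_
  filter_upwards [h2] with n hn
  simp only [hG, hm]
  congr 2
  ext j
  exact hn j j.2

/-! ### Increments of functions of the eigenvalues -/

lemma norm_exp_mul_I_sub_one_sub_le (d : ℝ) :
    ‖Complex.exp (d * Complex.I) - 1 - d * Complex.I‖ ≤ 3 * d ^ 2 := by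
  have hn : ‖(d * Complex.I : ℂ)‖ = |d| := by simp
  rcases le_or_gt |d| 1 with h | h
  · have h1 := Complex.norm_exp_sub_one_sub_id_le (x := d * Complex.I) (by rwa [hn])
    rw [hn, sq_abs] at h1
    nlinarith [sq_nonneg d]
  · have h1 := norm_sub_le (Complex.exp (d * Complex.I) - 1) (d * Complex.I)
    have h2 := norm_sub_le (Complex.exp (d * Complex.I)) 1
    rw [Complex.norm_exp_ofReal_mul_I, norm_one] at h2
    rw [hn] at h1
    have h3 := sq_abs d
    nlinarith

lemma norm_exp_mul_I_sub_sub_le (a b : ℝ) :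
    ‖Complex.exp (a * Complex.I) - Complex.exp (b * Complex.I) -
      Complex.I * Complex.exp (a * Complex.I) * (a - b)‖ ≤ 3 * (a - b) ^ 2 := by
  have h1 : Complex.exp (a * Complex.I) - Complex.exp (b * Complex.I) -
      Complex.I * Complex.exp (a * Complex.I) * (a - b) = -(Complex.exp (a * Complex.I) *
        (Complex.exp (((b - a : ℝ) : ℂ) * Complex.I) - 1 - ((b - a : ℝ) : ℂ) * Complex.I)) := by
    have hc : ((b - a : ℝ) : ℂ) = b - a := Complex.ofReal_sub b a
    have he : Complex.exp (a * Complex.I) * Complex.exp (((b - a : ℝ) : ℂ) * Complex.I) =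
        Complex.exp (b * Complex.I) := by
      rw [← Complex.exp_add, hc]
      congr 1
      ring
    linear_combination he - Complex.exp (a * Complex.I) * Complex.I * hc
  rw [h1, norm_neg, norm_mul, Complex.norm_exp_ofReal_mul_I, one_mul]
  refine (norm_exp_mul_I_sub_one_sub_le (b - a)).trans_eq ?_
  ring

lemma abs_cos_sub_cos_sub_le (a b : ℝ) :
    |Real.cos a - Real.cos b - -Real.sin a * (a - b)| ≤ 3 * (a - b) ^ 2 := by
  have h := (Complex.abs_re_le_norm _).trans (norm_exp_mul_I_sub_sub_le a b)
  simpa [Complex.exp_ofReal_mul_I_re, Complex.exp_ofReal_mul_I_im] using h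

lemma abs_sin_sub_sin_sub_le (a b : ℝ) :
    |Real.sin a - Real.sin b - Real.cos a * (a - b)| ≤ 3 * (a - b) ^ 2 := by
  have h := (Complex.abs_im_le_norm _).trans (norm_exp_mul_I_sub_sub_le a b)
  simpa [Complex.exp_ofReal_mul_I_re, Complex.exp_ofReal_mul_I_im] using h

lemma normalizedDFT_sub_update {n : ℕ} (y : Fin n → ℂ) (j k : Fin n) :
    normalizedDFT y k - normalizedDFT (Function.update y j 0) k =
      ((Real.sqrt n : ℝ) : ℂ)⁻¹ * (y j * unitRoot n ^ (j * k : ℕ)) := by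
  simp only [normalizedDFT]
  rw [← mul_sub, ← Finset.sum_sub_distrib, Finset.sum_eq_single j]
  · simp
  · intro i _ hi
    simp [Function.update_of_ne hi]
  · simp

lemma norm_sqrt_inv (n : ℕ) : ‖((Real.sqrt n : ℝ) : ℂ)⁻¹‖ = (Real.sqrt n)⁻¹ := by
  rw [norm_inv, Complex.norm_real, Real.norm_of_nonneg (Real.sqrt_nonneg _)]

/-- The average of `φ (⟨λ_k, t⟩)` over the entries `λ_k` of the discrete Fourier transform of `y`. -/
noncomputable def spectralAverage (φ : ℝ → ℝ) (t : ℂ) (n : ℕ) (y : Fin n → ℂ) : ℝ :=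
  (n : ℝ)⁻¹ * ∑ k, φ (inner ℝ (normalizedDFT y k) t)

lemma measurable_normalizedDFT {n : ℕ} (k : Fin n) :
    Measurable fun y : Fin n → ℂ => normalizedDFT y k := by
  unfold normalizedDFT
  fun_prop

lemma measurable_spectralAverage {φ : ℝ → ℝ} (hφ : Measurable φ) (t : ℂ) (n : ℕ) :
    Measurable (spectralAverage φ t n) := by
  refine (Finset.measurable_sum _ fun k _ => hφ.comp ?_).const_mul _
  exact (measurable_normalizedDFT k).inner measurable_const

lemma abs_spectralAverage_le {φ : ℝ → ℝ} (hφ : ∀ a, |φ a| ≤ 1) (t : ℂ) (n : ℕ)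
    (y : Fin n → ℂ) : |spectralAverage φ t n y| ≤ 1 := by
  rw [spectralAverage, abs_mul, abs_of_nonneg (by positivity : (0 : ℝ) ≤ (n : ℝ)⁻¹)]
  have h1 : |∑ k, φ (inner ℝ (normalizedDFT y k) t)| ≤ n := by
    refine (Finset.abs_sum_le_sum_abs _ _).trans ?_
    refine (Finset.sum_le_sum fun k _ => hφ _).trans_eq ?_
    simp
  rcases Nat.eq_zero_or_pos n with rfl | hn
  · simp
  · rw [inv_mul_le_iff₀ (by exact_mod_cast hn)]
    simpa using h1

/-- Zeroing the coordinate `j` changes a spectral average, to first order, by `n⁻¹` times the inner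
product of `t` with `y j` times the `j`-th Fourier coefficient of the derivatives `ψ (⟨λ_k, t⟩)`. By
Parseval's identity the squares of these terms add up to `O(K² / n)`; the second-order terms are
`O(K² / n)` each. -/
lemma sum_sq_spectralAverage_sub_update_le {φ ψ : ℝ → ℝ} (hψ : ∀ a, |ψ a| ≤ 1)
    (hφ : ∀ a b, |φ a - φ b - ψ a * (a - b)| ≤ 3 * (a - b) ^ 2) (t : ℂ) (n : ℕ) {K : ℝ}
    (hK : 1 ≤ K) (y : Fin n → ℂ) (hy : ∀ j, ‖y j‖ ≤ K) :
    ∑ j, (spectralAverage φ t n y - spectralAverage φ t n (Function.update y j 0)) ^ 2 ≤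
      (2 * ‖t‖ ^ 2 + 18 * ‖t‖ ^ 4) * K ^ 4 / n := by
  rcases Nat.eq_zero_or_pos n with rfl | hn
  · simp
  have : NeZero n := ⟨hn.ne'⟩
  have hn0 : (0 : ℝ) < n := by exact_mod_cast hn
  have hsn : (Real.sqrt n)⁻¹ ^ 2 = (n : ℝ)⁻¹ := by
    rw [inv_pow, Real.sq_sqrt hn0.le]
  set w : Fin n → ℂ := fun k => (ψ (inner ℝ (normalizedDFT y k) t) : ℂ) with hw
  set d : Fin n → Fin n → ℝ := fun j k => inner ℝ
    (((Real.sqrt n : ℝ) : ℂ)⁻¹ * (y j * unitRoot n ^ (j * k : ℕ))) t with hd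
  have hd_eq : ∀ j k, inner ℝ (normalizedDFT y k) t -
      inner ℝ (normalizedDFT (Function.update y j 0) k) t = d j k := fun j k => by
    rw [← inner_sub_left, normalizedDFT_sub_update]
  have hd_sq : ∀ j k, d j k ^ 2 ≤ (n : ℝ)⁻¹ * (K ^ 2 * ‖t‖ ^ 2) := by
    intro j k
    have h1 : |d j k| ≤ (Real.sqrt n)⁻¹ * (K * ‖t‖) := by
      refine (abs_real_inner_le_norm _ _).trans ?_
      rw [norm_mul, norm_mul, norm_pow, norm_unitRoot, one_pow, mul_one, norm_sqrt_inv, mul_assoc]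
      gcongr
      exact hy j
    rw [← sq_abs]
    refine (pow_le_pow_left₀ (abs_nonneg _) h1 2).trans_eq ?_
    rw [mul_pow, hsn, mul_pow]
  -- the first-order part of the increment is governed by the discrete Fourier transform of `w`
  have hmain : ∀ j, ∑ k, ψ (inner ℝ (normalizedDFT y k) t) * d j k =
      inner ℝ (y j * normalizedDFT w j) t := by
    intro j
    have h1 : y j * normalizedDFT w j = ∑ k, (ψ (inner ℝ (normalizedDFT y k) t)) •
        (((Real.sqrt n : ℝ) : ℂ)⁻¹ * (y j * unitRoot n ^ (j * k : ℕ))) := by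
      simp only [normalizedDFT, hw, Finset.mul_sum, Complex.real_smul]
      refine Finset.sum_congr rfl fun k _ => ?_
      rw [mul_comm (j : ℕ)]
      ring
    rw [h1, sum_inner]
    exact Finset.sum_congr rfl fun k _ => by rw [real_inner_smul_left]
  have hΔ : ∀ j, |spectralAverage φ t n y - spectralAverage φ t n (Function.update y j 0) -
      (n : ℝ)⁻¹ * inner ℝ (y j * normalizedDFT w j) t| ≤ 3 * (K ^ 2 * ‖t‖ ^ 2) / n := by
    intro j
    rw [← hmain, spectralAverage, spectralAverage, ← mul_sub, ← mul_sub,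
      ← Finset.sum_sub_distrib, ← Finset.sum_sub_distrib, abs_mul,
      abs_of_nonneg (by positivity : (0 : ℝ) ≤ (n : ℝ)⁻¹), inv_mul_le_iff₀ hn0]
    refine (Finset.abs_sum_le_sum_abs _ _).trans ?_
    have h1 : ∀ k, |φ (inner ℝ (normalizedDFT y k) t) -
        φ (inner ℝ (normalizedDFT (Function.update y j 0) k) t) -
        ψ (inner ℝ (normalizedDFT y k) t) * d j k| ≤ 3 * (K ^ 2 * ‖t‖ ^ 2) / n := by
      intro k
      have h2 := hφ (inner ℝ (normalizedDFT y k) t)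
        (inner ℝ (normalizedDFT (Function.update y j 0) k) t)
      rw [hd_eq] at h2
      refine h2.trans ?_
      have := hd_sq j k
      rw [div_eq_mul_inv]
      linarith
    refine (Finset.sum_le_sum fun k _ => h1 k).trans_eq ?_
    simp
  have hsq : ∀ j, (spectralAverage φ t n y -
      spectralAverage φ t n (Function.update y j 0)) ^ 2 ≤
      2 * ((n : ℝ)⁻¹ ^ 2 * (K ^ 2 * ‖t‖ ^ 2)) * ‖normalizedDFT w j‖ ^ 2 +
        2 * (3 * (K ^ 2 * ‖t‖ ^ 2) / n) ^ 2 := by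
    intro j
    set u := spectralAverage φ t n y - spectralAverage φ t n (Function.update y j 0)
    set v := (n : ℝ)⁻¹ * inner ℝ (y j * normalizedDFT w j) t with hv
    have h1 : (u - v) ^ 2 ≤ (3 * (K ^ 2 * ‖t‖ ^ 2) / n) ^ 2 := by
      rw [← sq_abs]
      exact pow_le_pow_left₀ (abs_nonneg _) (hΔ j) 2
    have h2 : |v| ≤ (n : ℝ)⁻¹ * (K * ‖normalizedDFT w j‖ * ‖t‖) := by
      rw [hv, abs_mul, abs_of_nonneg (by positivity : (0 : ℝ) ≤ (n : ℝ)⁻¹)]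
      refine mul_le_mul_of_nonneg_left ((abs_real_inner_le_norm _ _).trans ?_) (by positivity)
      rw [norm_mul]
      gcongr
      exact hy j
    have h3 : v ^ 2 ≤ (n : ℝ)⁻¹ ^ 2 * (K ^ 2 * ‖t‖ ^ 2) * ‖normalizedDFT w j‖ ^ 2 := by
      rw [← sq_abs]
      refine (pow_le_pow_left₀ (abs_nonneg _) h2 2).trans_eq ?_
      ring
    nlinarith [sq_nonneg (u - 2 * v)]
  have hparseval : ∑ j, ‖normalizedDFT w j‖ ^ 2 ≤ n := by
    rw [sum_norm_sq_normalizedDFT]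
    refine (Finset.sum_le_sum (g := fun _ => (1 : ℝ)) fun k _ => ?_).trans_eq (by simp)
    rw [hw, Complex.norm_real, Real.norm_eq_abs]
    exact pow_le_one₀ (abs_nonneg _) (hψ _)
  have hK4 : K ^ 2 ≤ K ^ 4 := pow_le_pow_right₀ hK (by norm_num)
  calc ∑ j, (spectralAverage φ t n y - spectralAverage φ t n (Function.update y j 0)) ^ 2
      ≤ ∑ j, (2 * ((n : ℝ)⁻¹ ^ 2 * (K ^ 2 * ‖t‖ ^ 2)) * ‖normalizedDFT w j‖ ^ 2 +
        2 * (3 * (K ^ 2 * ‖t‖ ^ 2) / n) ^ 2) := Finset.sum_le_sum fun j _ => hsq j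
    _ = 2 * ((n : ℝ)⁻¹ ^ 2 * (K ^ 2 * ‖t‖ ^ 2)) * ∑ j, ‖normalizedDFT w j‖ ^ 2 +
        n * (2 * (3 * (K ^ 2 * ‖t‖ ^ 2) / n) ^ 2) := by
        rw [Finset.sum_add_distrib, ← Finset.mul_sum]
        simp
    _ ≤ 2 * ((n : ℝ)⁻¹ ^ 2 * (K ^ 2 * ‖t‖ ^ 2)) * n +
        n * (2 * (3 * (K ^ 2 * ‖t‖ ^ 2) / n) ^ 2) := by gcongr
    _ = (2 * ‖t‖ ^ 2 * K ^ 2 + 18 * ‖t‖ ^ 4 * K ^ 4) / n := by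
        field_simp
        ring
    _ ≤ (2 * ‖t‖ ^ 2 + 18 * ‖t‖ ^ 4) * K ^ 4 / n := by
        refine div_le_div_of_nonneg_right ?_ hn0.le
        nlinarith [mul_le_mul_of_nonneg_left hK4 (sq_nonneg ‖t‖)]

/-- The average of `‖y j‖²`. -/
noncomputable def meanNormSq (n : ℕ) (y : Fin n → ℂ) : ℝ := (n : ℝ)⁻¹ * ∑ j, ‖y j‖ ^ 2

lemma measurable_meanNormSq (n : ℕ) : Measurable (meanNormSq n) := by
  unfold meanNormSq
  fun_prop

lemma meanNormSq_nonneg (n : ℕ) (y : Fin n → ℂ) : 0 ≤ meanNormSq n y := by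
  unfold meanNormSq
  positivity

lemma meanNormSq_le {n : ℕ} {K : ℝ} {y : Fin n → ℂ} (hy : ∀ j, ‖y j‖ ≤ K) :
    meanNormSq n y ≤ K ^ 2 := by
  rcases Nat.eq_zero_or_pos n with rfl | hn
  · simpa [meanNormSq] using sq_nonneg K
  rw [meanNormSq, inv_mul_le_iff₀ (by exact_mod_cast hn)]
  refine (Finset.sum_le_sum fun j _ => pow_le_pow_left₀ (norm_nonneg _) (hy j) 2).trans_eq ?_
  simp

lemma sum_sq_meanNormSq_sub_update_le (n : ℕ) {K : ℝ} (y : Fin n → ℂ) (hy : ∀ j, ‖y j‖ ≤ K) :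
    ∑ j, (meanNormSq n y - meanNormSq n (Function.update y j 0)) ^ 2 ≤ 1 * K ^ 4 / n := by
  rcases Nat.eq_zero_or_pos n with rfl | hn
  · simp
  have hn0 : (0 : ℝ) < n := by exact_mod_cast hn
  have h1 : ∀ j, meanNormSq n y - meanNormSq n (Function.update y j 0) =
      (n : ℝ)⁻¹ * ‖y j‖ ^ 2 := by
    intro j
    rw [meanNormSq, meanNormSq, ← mul_sub, ← Finset.sum_sub_distrib, Finset.sum_eq_single j]
    · simp
    · intro i _ hi
      simp [Function.update_of_ne hi]
    · simp
  have h2 : ∀ j, (meanNormSq n y - meanNormSq n (Function.update y j 0)) ^ 2 ≤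
      (n : ℝ)⁻¹ ^ 2 * K ^ 4 := by
    intro j
    rw [h1, mul_pow, ← pow_mul]
    exact mul_le_mul_of_nonneg_left (pow_le_pow_left₀ (norm_nonneg _) (hy j) 4) (by positivity)
  refine (Finset.sum_le_sum fun j _ => h2 j).trans_eq ?_
  simp only [Finset.sum_const, Finset.card_univ, Fintype.card_fin, nsmul_eq_mul]
  field_simp

/-! ### Taylor estimates for characteristic functions -/

lemma norm_prod_sub_prod_le_sum {ι : Type*} (s : Finset ι) {a b : ι → ℂ} (ha : ∀ i, ‖a i‖ ≤ 1)
    (hb : ∀ i, ‖b i‖ ≤ 1) : ‖∏ i ∈ s, a i - ∏ i ∈ s, b i‖ ≤ ∑ i ∈ s, ‖a i - b i‖ := by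
  classical
  induction s using Finset.induction_on with
  | empty => simp
  | insert i s hi ih =>
    rw [Finset.prod_insert hi, Finset.prod_insert hi, Finset.sum_insert hi]
    have h1 : a i * ∏ j ∈ s, a j - b i * ∏ j ∈ s, b j =
        (a i - b i) * ∏ j ∈ s, a j + b i * (∏ j ∈ s, a j - ∏ j ∈ s, b j) := by ring
    rw [h1]
    refine (norm_add_le _ _).trans (add_le_add ?_ ?_)
    · rw [norm_mul]
      refine mul_le_of_le_one_right (norm_nonneg _) ?_
      rw [norm_prod]
      exact Finset.prod_le_one (fun _ _ => norm_nonneg _) fun j _ => ha j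
    · rw [norm_mul]
      exact (mul_le_of_le_one_left (norm_nonneg _) (hb i)).trans ih

lemma norm_exp_mul_I_sub_taylor_two_le (d : ℝ) :
    ‖Complex.exp (d * Complex.I) - (1 + d * Complex.I - d ^ 2 / 2)‖ ≤ 4 * |d| ^ 3 := by
  have hn : ‖(d * Complex.I : ℂ)‖ = |d| := by simp
  rcases le_or_gt |d| 1 with h | h
  · have h1 := Complex.exp_bound (x := d * Complex.I) (by rwa [hn]) (n := 3) (by norm_num)
    rw [hn] at h1
    have h2 : ∑ m ∈ Finset.range 3, (d * Complex.I : ℂ) ^ m / m.factorial =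
        1 + d * Complex.I - d ^ 2 / 2 := by
      simp [Finset.sum_range_succ, mul_pow, Nat.factorial]
      ring
    rw [h2] at h1
    refine h1.trans ?_
    have h3 : (0 : ℝ) ≤ |d| ^ 3 := by positivity
    norm_num [Nat.factorial]
    nlinarith
  · have h1 := norm_sub_le (Complex.exp (d * Complex.I) - 1 - d * Complex.I) (-(d : ℂ) ^ 2 / 2)
    have h2 := norm_exp_mul_I_sub_one_sub_le d
    have h3 : ‖(-(d : ℂ) ^ 2 / 2)‖ = d ^ 2 / 2 := by
      simp
    have h4 : Complex.exp (d * Complex.I) - (1 + d * Complex.I - d ^ 2 / 2) =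
        Complex.exp (d * Complex.I) - 1 - d * Complex.I - (-(d : ℂ) ^ 2 / 2) := by ring
    rw [h4]
    rw [h3] at h1
    have h5 : d ^ 2 ≤ |d| ^ 3 := by
      rw [← sq_abs]
      exact pow_le_pow_right₀ h.le (by norm_num)
    nlinarith [sq_nonneg d]

lemma abs_exp_neg_sub_le {u : ℝ} (hu : 0 ≤ u) : |Real.exp (-u) - (1 - u)| ≤ u ^ 2 := by
  rcases le_or_gt u 1 with h | h
  · have h1 := Real.abs_exp_sub_one_sub_id_le (x := -u) (by rwa [abs_neg, abs_of_nonneg hu])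
    rw [neg_sq] at h1
    convert h1 using 2
    ring
  · have h1 := Real.add_one_le_exp (-u)
    have h2 : Real.exp (-u) ≤ 1 := Real.exp_le_one_iff.mpr (by linarith)
    rw [abs_le]
    constructor <;> nlinarith

/-- The characteristic function of a centred variable, compared with that of the Gaussian of the same
variance. -/
lemma norm_integral_exp_mul_I_sub_le {Ω : Type*} [MeasurableSpace Ω] {P : Measure Ω}
    [IsProbabilityMeasure P] {Y : Ω → ℝ} (hm : Measurable Y) (h1 : Integrable Y P)
    (h2 : Integrable (fun ω => Y ω ^ 2) P) (h3 : Integrable (fun ω => |Y ω| ^ 3) P)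
    (h0 : ∫ ω, Y ω ∂P = 0) :
    ‖∫ ω, Complex.exp (Y ω * Complex.I) ∂P - (Real.exp (-((∫ ω, Y ω ^ 2 ∂P) / 2)) : ℂ)‖ ≤
      4 * ∫ ω, |Y ω| ^ 3 ∂P + (∫ ω, Y ω ^ 2 ∂P) ^ 2 := by
  set v := ∫ ω, Y ω ^ 2 ∂P with hv
  have hv0 : 0 ≤ v := integral_nonneg fun ω => sq_nonneg _
  have hexp : Integrable (fun ω => Complex.exp (Y ω * Complex.I)) P :=
    Integrable.of_bound (by fun_prop) 1
      (Eventually.of_forall fun ω => (Complex.norm_exp_ofReal_mul_I _).le)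
  have hY : Integrable (fun ω => (Y ω : ℂ) * Complex.I) P := h1.ofReal.mul_const _
  have hY2 : Integrable (fun ω => (Y ω : ℂ) ^ 2 / 2) P := by
    simpa using (h2.ofReal (𝕜 := ℂ)).div_const 2
  have hone : Integrable (fun _ : Ω => (1 : ℂ)) P := integrable_const _
  have hpoly : ∫ ω, (1 + (Y ω : ℂ) * Complex.I - (Y ω : ℂ) ^ 2 / 2) ∂P = ((1 - v / 2 : ℝ) : ℂ) := by
    rw [integral_sub (f := fun ω => 1 + (Y ω : ℂ) * Complex.I) (hone.add hY) hY2,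
      integral_add hone hY, integral_mul_const, integral_div, integral_complex_ofReal, h0]
    have : ∫ ω, (Y ω : ℂ) ^ 2 ∂P = (v : ℂ) := by
      rw [hv, ← integral_complex_ofReal]
      simp
    rw [this]
    simp
  have ha : ‖∫ ω, Complex.exp (Y ω * Complex.I) ∂P - ((1 - v / 2 : ℝ) : ℂ)‖ ≤
      4 * ∫ ω, |Y ω| ^ 3 ∂P := by
    have hp : Integrable (fun ω => 1 + (Y ω : ℂ) * Complex.I - (Y ω : ℂ) ^ 2 / 2) P :=
      (hone.add hY).sub hY2
    rw [← hpoly, ← integral_sub hexp hp, ← integral_const_mul]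
    exact norm_integral_le_of_norm_le (h3.const_mul 4)
      (Eventually.of_forall fun ω => norm_exp_mul_I_sub_taylor_two_le (Y ω))
  have hb : ‖((1 - v / 2 : ℝ) : ℂ) - (Real.exp (-(v / 2)) : ℂ)‖ ≤ v ^ 2 := by
    rw [← Complex.ofReal_sub, Complex.norm_real, Real.norm_eq_abs, abs_sub_comm]
    refine (abs_exp_neg_sub_le (by positivity)).trans ?_
    nlinarith [sq_nonneg v]
  exact (norm_sub_le_norm_sub_add_norm_sub _ _ _).trans (add_le_add ha hb)

lemma card_filter_dvd_two_mul_le (n : ℕ) [NeZero n] :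
    (Finset.univ.filter fun k : Fin n => n ∣ 2 * (k : ℕ)).card ≤ 2 := by
  rw [← Finset.card_image_of_injective _ Fin.val_injective]
  refine (Finset.card_le_card (t := {0, n / 2}) fun m hm => ?_).trans Finset.card_le_two
  simp only [Finset.mem_image, Finset.mem_filter, Finset.mem_univ, true_and] at hm
  obtain ⟨k, ⟨c, hc⟩, rfl⟩ := hm
  have hk := k.2
  have hc2 : c < 2 := by
    by_contra h
    have : n * 2 ≤ n * c := Nat.mul_le_mul_left n (by omega)
    omega
  rw [Finset.mem_insert, Finset.mem_singleton]
  rcases (by omega : c = 0 ∨ c = 1) with rfl | rfl <;> omega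

/-! ### Convergence of the expected characteristic function -/

lemma sq_re_mul_conj (w z : ℂ) :
    (w * (starRingEnd ℂ) z).re ^ 2 =
      (‖w‖ ^ 2 * ‖z‖ ^ 2 + (w ^ 2 * (starRingEnd ℂ) (z ^ 2)).re) / 2 := by
  rw [Complex.sq_norm, Complex.sq_norm, Complex.normSq_apply, Complex.normSq_apply]
  simp [pow_two]
  ring

/-- The coefficient of `conj (y j)` in `⟨λ_k, t⟩`, before taking real parts. -/
noncomputable def dftWeight (t : ℂ) {n : ℕ} (k j : Fin n) : ℂ :=
  t * (starRingEnd ℂ) (((Real.sqrt n : ℝ) : ℂ)⁻¹ * unitRoot n ^ (j * k : ℕ))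

lemma inner_normalizedDFT {n : ℕ} (y : Fin n → ℂ) (k : Fin n) (t : ℂ) :
    inner ℝ (normalizedDFT y k) t = ∑ j, (dftWeight t k j * (starRingEnd ℂ) (y j)).re := by
  rw [Complex.inner, normalizedDFT, Finset.mul_sum, map_sum, Finset.mul_sum, Complex.re_sum]
  refine Finset.sum_congr rfl fun j _ => ?_
  rw [dftWeight, map_mul, map_mul, map_mul]
  congr 1
  ring

lemma norm_dftWeight (t : ℂ) {n : ℕ} [NeZero n] (k j : Fin n) :
    ‖dftWeight t k j‖ = ‖t‖ * (Real.sqrt n)⁻¹ := by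
  rw [dftWeight, norm_mul, RCLike.norm_conj, norm_mul, norm_sqrt_inv, norm_pow, norm_unitRoot,
    one_pow, mul_one]

lemma sum_dftWeight_sq (t : ℂ) {n : ℕ} [NeZero n] (k : Fin n) (hk : ¬ n ∣ 2 * (k : ℕ)) :
    ∑ j, dftWeight t k j ^ 2 = 0 := by
  have h : ∀ j, dftWeight t k j ^ 2 = t ^ 2 * (starRingEnd ℂ) (((Real.sqrt n : ℝ) : ℂ)⁻¹ ^ 2) *
      (starRingEnd ℂ) ((unitRoot n ^ (j * k : ℕ)) ^ 2) := by
    intro j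
    rw [dftWeight, mul_pow, ← map_pow, mul_pow, map_mul]
    ring
  simp only [h]
  rw [← Finset.mul_sum, ← map_sum, sum_unitRoot_pow_sq_eq_zero hk]
  simp

/-- The central limit theorem for a single eigenvalue, with an error bound. When `n ∣ 2k` the number
`α` enters the variance, and the limit may differ. -/
theorem norm_integral_exp_inner_normalizedDFT_sub_le {Ω : Type*} [MeasurableSpace Ω]
    (P : Measure Ω) [IsProbabilityMeasure P] (X : ℕ → Ω → ℂ) (hmeas : ∀ j, Measurable (X j))
    (hindep : iIndepFun X P) (α : ℂ) (hmean : ∀ j, ∫ ω, X j ω ∂P = 0)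
    (hsq : ∀ j, ∫ ω, X j ω ^ 2 ∂P = α) (habs : ∀ j, ∫ ω, ‖X j ω‖ ^ 2 ∂P = 1) {M : ℝ}
    (hM : ∀ j, Integrable (fun ω => ‖X j ω‖ ^ 3) P ∧ ∫ ω, ‖X j ω‖ ^ 3 ∂P ≤ M) (t : ℂ) {n : ℕ}
    [NeZero n] (k : Fin n) (hk : ¬ n ∣ 2 * (k : ℕ)) :
    ‖∫ ω, Complex.exp (inner ℝ (normalizedDFT (fun j : Fin n => X j ω) k) t * Complex.I) ∂P -
      (Real.exp (-(‖t‖ ^ 2 / 4)) : ℂ)‖ ≤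
      4 * ‖t‖ ^ 3 * M * (Real.sqrt n)⁻¹ + ‖t‖ ^ 4 * (n : ℝ)⁻¹ := by
  have hn0 : (0 : ℝ) < n := by exact_mod_cast Nat.pos_of_ne_zero (NeZero.ne n)
  set r : ℝ := (Real.sqrt n)⁻¹ with hr
  have hr2 : r ^ 2 = (n : ℝ)⁻¹ := by rw [hr, inv_pow, Real.sq_sqrt hn0.le]
  have hnr : (n : ℝ) * r ^ 2 = 1 := by rw [hr2, mul_inv_cancel₀ hn0.ne']
  have hr0 : 0 ≤ r := by positivity
  have hX2 : ∀ j, Integrable (fun ω => ‖X j ω‖ ^ 2) P := fun j =>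
    integrable_norm_sq_of_integral_eq_one (habs j)
  have hX1 : ∀ j, Integrable (X j) P := fun j =>
    (((memLp_two_iff_integrable_sq_norm (hmeas j).aestronglyMeasurable).mpr (hX2 j)).integrable
      one_le_two)
  have hXsq : ∀ j, Integrable (fun ω => X j ω ^ 2) P := fun j =>
    (hX2 j).mono' ((hmeas j).pow_const 2).aestronglyMeasurable
      (Eventually.of_forall fun ω => (norm_pow _ _).le)
  set w : Fin n → ℂ := fun j => dftWeight t k j with hw
  have hwn : ∀ j, ‖w j‖ = ‖t‖ * r := fun j => norm_dftWeight t k j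
  set Y : Fin n → Ω → ℝ := fun j ω => (w j * (starRingEnd ℂ) (X j ω)).re with hY
  have hconj : Measurable (starRingEnd ℂ) := Complex.continuous_conj.measurable
  have hYm : ∀ j, Measurable (Y j) := fun j =>
    Complex.measurable_re.comp ((hconj.comp (hmeas j)).const_mul _)
  have hYle : ∀ j ω, |Y j ω| ≤ ‖t‖ * r * ‖X j ω‖ := fun j ω => by
    refine (Complex.abs_re_le_norm _).trans_eq ?_
    rw [norm_mul, RCLike.norm_conj, hwn]
  have hconjint : ∀ {Z : Ω → ℂ}, Integrable Z P → Integrable (fun ω => (starRingEnd ℂ) (Z ω)) P :=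
    fun {Z} hZ => (Complex.conjCLE : ℂ →L[ℝ] ℂ).integrable_comp hZ
  have hYi : ∀ j, Integrable (Y j) P := fun j => ((hconjint (hX1 j)).const_mul (w j)).re
  have hY2eq : ∀ j ω, Y j ω ^ 2 =
      (‖w j‖ ^ 2 * ‖X j ω‖ ^ 2 + (w j ^ 2 * (starRingEnd ℂ) (X j ω ^ 2)).re) / 2 := fun j ω =>
    sq_re_mul_conj _ _
  have hre : ∀ j, Integrable (fun ω => (w j ^ 2 * (starRingEnd ℂ) (X j ω ^ 2)).re) P := fun j =>
    ((hconjint (hXsq j)).const_mul (w j ^ 2)).re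
  have hY2i : ∀ j, Integrable (fun ω => Y j ω ^ 2) P := fun j => by
    simp only [hY2eq]
    exact (((hX2 j).const_mul _).add (hre j)).div_const 2
  have hY3i : ∀ j, Integrable (fun ω => |Y j ω| ^ 3) P := fun j => by
    refine ((hM j).1.const_mul ((‖t‖ * r) ^ 3)).mono'
      ((hYm j).abs.pow_const 3).aestronglyMeasurable (Eventually.of_forall fun ω => ?_)
    rw [norm_pow, Real.norm_eq_abs, abs_abs, ← mul_pow]
    exact pow_le_pow_left₀ (abs_nonneg _) (hYle j ω) 3
  have hY0 : ∀ j, ∫ ω, Y j ω ∂P = 0 := fun j => by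
    have h1 := integral_re ((hconjint (hX1 j)).const_mul (w j))
    rw [integral_const_mul, integral_conj, hmean j, map_zero, mul_zero, map_zero] at h1
    exact h1
  have hYv : ∀ j, ∫ ω, Y j ω ^ 2 ∂P =
      (‖t‖ ^ 2 * r ^ 2 + (w j ^ 2 * (starRingEnd ℂ) α).re) / 2 := fun j => by
    have h1 := integral_re ((hconjint (hXsq j)).const_mul (w j ^ 2))
    rw [integral_const_mul, integral_conj, hsq j] at h1
    simp only [hY2eq]
    rw [integral_div, integral_add ((hX2 j).const_mul _) (hre j), integral_const_mul, habs j,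
      hwn, mul_pow, mul_one]
    congr 2
  have hYvle : ∀ j, ∫ ω, Y j ω ^ 2 ∂P ≤ ‖t‖ ^ 2 * r ^ 2 := fun j => by
    have h1 : ∀ ω, Y j ω ^ 2 ≤ (‖t‖ * r) ^ 2 * ‖X j ω‖ ^ 2 := fun ω => by
      rw [← sq_abs, ← mul_pow]
      exact pow_le_pow_left₀ (abs_nonneg _) (hYle j ω) 2
    refine (integral_mono (hY2i j) ((hX2 j).const_mul _) h1).trans_eq ?_
    rw [integral_const_mul, habs j]
    ring
  have hY3le : ∀ j, ∫ ω, |Y j ω| ^ 3 ∂P ≤ ‖t‖ ^ 3 * r ^ 3 * M := fun j => by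
    have h1 : ∀ ω, |Y j ω| ^ 3 ≤ (‖t‖ * r) ^ 3 * ‖X j ω‖ ^ 3 := fun ω => by
      rw [← mul_pow]
      exact pow_le_pow_left₀ (abs_nonneg _) (hYle j ω) 3
    refine (integral_mono (hY3i j) ((hM j).1.const_mul _) h1).trans ?_
    rw [integral_const_mul, mul_pow]
    exact mul_le_mul_of_nonneg_left (hM j).2 (by positivity)
  -- the total variance is exactly `‖t‖² / 2`, because the weights' squares sum to zero
  have hvar : ∑ j, ∫ ω, Y j ω ^ 2 ∂P = ‖t‖ ^ 2 / 2 := by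
    have h0 : ∑ j, (w j ^ 2 * (starRingEnd ℂ) α).re = 0 := by
      rw [← Complex.re_sum, ← Finset.sum_mul, sum_dftWeight_sq t k hk, zero_mul, Complex.zero_re]
    simp only [hYv]
    rw [← Finset.sum_div, Finset.sum_add_distrib, h0]
    simp only [Finset.sum_const, Finset.card_univ, Fintype.card_fin, nsmul_eq_mul, add_zero]
    rw [mul_left_comm, hnr, mul_one]
  have hprod : ∫ ω, Complex.exp
      (inner ℝ (normalizedDFT (fun j : Fin n => X j ω) k) t * Complex.I) ∂P =
      ∏ j, ∫ ω, Complex.exp (Y j ω * Complex.I) ∂P := by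
    have hind : iIndepFun (fun j : Fin n => X j) P := hindep.precomp Fin.val_injective
    have h1 := hind.integral_fun_prod_comp
      (f := fun (j : Fin n) z => Complex.exp ((w j * (starRingEnd ℂ) z).re * Complex.I))
      (fun j => (hmeas j).aemeasurable) (fun j => by
        refine Continuous.aestronglyMeasurable ?_
        fun_prop)
    rw [← h1]
    refine integral_congr_ae (Eventually.of_forall fun ω => ?_)
    simp only [inner_normalizedDFT]
    rw [Complex.ofReal_sum, Finset.sum_mul, Complex.exp_sum]
  have hgauss : (Real.exp (-(‖t‖ ^ 2 / 4)) : ℂ) =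
      ∏ j, (Real.exp (-((∫ ω, Y j ω ^ 2 ∂P) / 2)) : ℂ) := by
    rw [← Complex.ofReal_prod, ← Real.exp_sum, Finset.sum_neg_distrib, ← Finset.sum_div, hvar]
    congr 3
    ring
  rw [hprod, hgauss]
  refine (norm_prod_sub_prod_le_sum _ (fun j => ?_) fun j => ?_).trans ?_
  · simpa using norm_integral_le_of_norm_le_const (μ := P)
      (f := fun ω => Complex.exp (Y j ω * Complex.I))
      (Eventually.of_forall fun ω => (Complex.norm_exp_ofReal_mul_I _).le)
  · rw [Complex.norm_real, Real.norm_of_nonneg (Real.exp_pos _).le, Real.exp_le_one_iff]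
    have : 0 ≤ ∫ ω, Y j ω ^ 2 ∂P := integral_nonneg fun ω => sq_nonneg _
    linarith
  · have hterm : ∀ j, ‖∫ ω, Complex.exp (Y j ω * Complex.I) ∂P -
        (Real.exp (-((∫ ω, Y j ω ^ 2 ∂P) / 2)) : ℂ)‖ ≤
        4 * (‖t‖ ^ 3 * r ^ 3 * M) + (‖t‖ ^ 2 * r ^ 2) ^ 2 := fun j => by
      refine (norm_integral_exp_mul_I_sub_le (hYm j) (hYi j) (hY2i j) (hY3i j) (hY0 j)).trans ?_
      have h0 : 0 ≤ ∫ ω, Y j ω ^ 2 ∂P := integral_nonneg fun ω => sq_nonneg _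
      exact add_le_add (mul_le_mul_of_nonneg_left (hY3le j) (by norm_num))
        (pow_le_pow_left₀ h0 (hYvle j) 2)
    refine (Finset.sum_le_sum fun j _ => hterm j).trans_eq ?_
    simp only [Finset.sum_const, Finset.card_univ, Fintype.card_fin, nsmul_eq_mul]
    rw [← hr2]
    linear_combination (4 * ‖t‖ ^ 3 * r * M + ‖t‖ ^ 4 * r ^ 2) * hnr

/-- The average of `exp (i ⟨λ_k, t⟩)` over the entries `λ_k` of the discrete Fourier transform of `y`. -/
noncomputable def empiricalCharFun (t : ℂ) (n : ℕ) (y : Fin n → ℂ) : ℂ :=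
  (n : ℂ)⁻¹ * ∑ k, Complex.exp (inner ℝ (normalizedDFT y k) t * Complex.I)

lemma measurable_empiricalCharFun (t : ℂ) (n : ℕ) : Measurable (empiricalCharFun t n) := by
  refine (Finset.measurable_sum _ fun k _ => ?_).const_mul _
  exact Complex.measurable_exp.comp ((Complex.measurable_ofReal.comp
    ((measurable_normalizedDFT k).inner measurable_const)).mul_const _)

theorem tendsto_integral_empiricalCharFun {Ω : Type*} [MeasurableSpace Ω]
    (P : Measure Ω) [IsProbabilityMeasure P] (X : ℕ → Ω → ℂ) (hmeas : ∀ j, Measurable (X j))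
    (hindep : iIndepFun X P) (α : ℂ) (hmean : ∀ j, ∫ ω, X j ω ∂P = 0)
    (hsq : ∀ j, ∫ ω, X j ω ^ 2 ∂P = α) (habs : ∀ j, ∫ ω, ‖X j ω‖ ^ 2 ∂P = 1) {M : ℝ}
    (hM0 : 0 ≤ M)
    (hM : ∀ j, Integrable (fun ω => ‖X j ω‖ ^ 3) P ∧ ∫ ω, ‖X j ω‖ ^ 3 ∂P ≤ M) (t : ℂ) :
    Tendsto (fun n : ℕ => ∫ ω, empiricalCharFun t n (fun j : Fin n => X j ω) ∂P) atTop
      (𝓝 (Real.exp (-(‖t‖ ^ 2 / 4)) : ℂ)) := by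
  set g : ℂ := (Real.exp (-(‖t‖ ^ 2 / 4)) : ℂ) with hg
  have hg1 : ‖g‖ ≤ 1 := by
    rw [hg, Complex.norm_real, Real.norm_of_nonneg (Real.exp_pos _).le, Real.exp_le_one_iff]
    linarith [sq_nonneg ‖t‖]
  have hlim : Tendsto (fun n : ℕ => 4 * ‖t‖ ^ 3 * M * (Real.sqrt n)⁻¹ +
      ‖t‖ ^ 4 * (n : ℝ)⁻¹ + 4 * (n : ℝ)⁻¹) atTop (𝓝 0) := by
    have h1 : Tendsto (fun n : ℕ => (n : ℝ)⁻¹) atTop (𝓝 0) :=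
      tendsto_inv_atTop_nhds_zero_nat
    have h2 : Tendsto (fun n : ℕ => (Real.sqrt n)⁻¹) atTop (𝓝 0) :=
      tendsto_inv_atTop_zero.comp (Real.tendsto_sqrt_atTop.comp tendsto_natCast_atTop_atTop)
    simpa using ((h2.const_mul (4 * ‖t‖ ^ 3 * M)).add (h1.const_mul (‖t‖ ^ 4))).add
      (h1.const_mul 4)
  rw [tendsto_iff_norm_sub_tendsto_zero]
  refine squeeze_zero' (Eventually.of_forall fun n => norm_nonneg _) ?_ hlim
  filter_upwards [eventually_ge_atTop 1] with n hn
  have : NeZero n := ⟨by omega⟩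
  have hn0 : (0 : ℝ) < n := by exact_mod_cast hn
  set e : Fin n → ℂ := fun k =>
    ∫ ω, Complex.exp (inner ℝ (normalizedDFT (fun j : Fin n => X j ω) k) t * Complex.I) ∂P with he
  have hXm : Measurable fun ω => fun j : Fin n => X j ω := measurable_pi_lambda _ fun j => hmeas j
  have hmk : ∀ k : Fin n, Measurable fun ω =>
      Complex.exp (inner ℝ (normalizedDFT (fun j : Fin n => X j ω) k) t * Complex.I) := fun k =>
    Complex.measurable_exp.comp ((Complex.measurable_ofReal.comp
      (((measurable_normalizedDFT k).comp hXm).inner measurable_const)).mul_const _)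
  have hint : ∫ ω, empiricalCharFun t n (fun j : Fin n => X j ω) ∂P = (n : ℂ)⁻¹ * ∑ k, e k := by
    simp only [empiricalCharFun]
    rw [integral_const_mul, integral_finsetSum _ fun k _ => ?_]
    exact Integrable.of_bound (hmk k).aestronglyMeasurable 1
      (Eventually.of_forall fun ω => (Complex.norm_exp_ofReal_mul_I _).le)
  have hdiff : (n : ℂ)⁻¹ * ∑ k, e k - g = (n : ℂ)⁻¹ * ∑ k, (e k - g) := by
    have : (n : ℂ) ≠ 0 := Nat.cast_ne_zero.mpr (by omega)
    rw [Finset.sum_sub_distrib]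
    simp
    field_simp
  rw [hint, hdiff, norm_mul, norm_inv, Complex.norm_natCast]
  set D : ℝ := 4 * ‖t‖ ^ 3 * M * (Real.sqrt n)⁻¹ + ‖t‖ ^ 4 * (n : ℝ)⁻¹ with hD
  have hD0 : 0 ≤ D := by positivity
  have hk : ∀ k : Fin n, ‖e k - g‖ ≤ D + if n ∣ 2 * (k : ℕ) then 2 else 0 := by
    intro k
    split_ifs with hdvd
    · have h1 : ‖e k‖ ≤ 1 :=
        (norm_integral_le_of_norm_le_const (Eventually.of_forall fun ω =>
          (Complex.norm_exp_ofReal_mul_I _).le)).trans_eq (by simp)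
      linarith [norm_sub_le (e k) g]
    · rw [add_zero]
      exact norm_integral_exp_inner_normalizedDFT_sub_le P X hmeas hindep α hmean hsq habs hM t k
        hdvd
  have hsum : ‖∑ k, (e k - g)‖ ≤ n * D + 4 := by
    refine (norm_sum_le _ _).trans ((Finset.sum_le_sum fun k _ => hk k).trans ?_)
    rw [Finset.sum_add_distrib, ← Finset.sum_filter]
    simp only [Finset.sum_const, Finset.card_univ, Fintype.card_fin, nsmul_eq_mul]
    have : ((Finset.univ.filter fun k : Fin n => n ∣ 2 * (k : ℕ)).card : ℝ) ≤ 2 := by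
      exact_mod_cast card_filter_dvd_two_mul_le n
    linarith
  rw [inv_mul_le_iff₀ hn0]
  refine hsum.trans_eq ?_
  field_simp

/-! ### Almost sure convergence -/

lemma charFun_stdComplexGaussian (t : ℂ) :
    charFun stdComplexGaussian t = (Real.exp (-(‖t‖ ^ 2 / 4)) : ℂ) := by
  have hd : Measurable fun z : ℂ => ENNReal.ofReal (1 / Real.pi * Real.exp (-‖z‖ ^ 2)) := by
    fun_prop
  have h1 := GaussianFourier.integral_cexp_neg_mul_sq_norm_add (b := 1) (V := ℂ) (by simp)
    Complex.I t
  rw [charFun_apply, stdComplexGaussian, integral_withDensity_eq_integral_toReal_smul hd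
    (Eventually.of_forall fun _ => ENNReal.ofReal_lt_top)]
  have h2 : ∀ z : ℂ, (ENNReal.ofReal (1 / Real.pi * Real.exp (-‖z‖ ^ 2))).toReal •
      Complex.exp (inner ℝ z t * Complex.I) =
      (Real.pi : ℂ)⁻¹ * Complex.exp (-1 * ‖z‖ ^ 2 + Complex.I * inner ℝ t z) := by
    intro z
    rw [ENNReal.toReal_ofReal (by positivity), Complex.real_smul, Complex.exp_add,
      real_inner_comm t z, mul_comm Complex.I]
    push_cast
    rw [neg_one_mul]
    ring
  simp only [h2]
  rw [integral_const_mul, h1, Complex.finrank_real_complex]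
  have hpi : (Real.pi : ℂ) ≠ 0 := Complex.ofReal_ne_zero.mpr Real.pi_ne_zero
  have h3 : ((Real.pi : ℂ) / 1) ^ (((2 : ℕ) : ℂ) / 2) = Real.pi := by
    rw [Nat.cast_ofNat, div_self two_ne_zero, Complex.cpow_one, div_one]
  rw [h3, ← mul_assoc, inv_mul_cancel₀ hpi, one_mul, Complex.I_sq, Complex.ofReal_exp]
  congr 1
  push_cast
  ring

lemma isProbabilityMeasure_stdComplexGaussian : IsProbabilityMeasure stdComplexGaussian := by
  have h := charFun_stdComplexGaussian 0
  rw [charFun_zero] at h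
  have h1 : stdComplexGaussian.real Set.univ = 1 := by
    have : ((stdComplexGaussian.real Set.univ : ℝ) : ℂ) = ((1 : ℝ) : ℂ) := by simpa using h
    exact Complex.ofReal_injective this
  exact ⟨(ENNReal.toReal_eq_one_iff _).mp h1⟩

lemma charFun_circulantSpectralMeasure (n : ℕ) [NeZero n] (x : ℕ → ℂ) (t : ℂ) :
    charFun (circulantSpectralMeasure n x) t = empiricalCharFun t n fun j => x j := by
  rw [charFun_apply, integral_circulantSpectralMeasure, empiricalCharFun, Complex.real_smul]
  simp

lemma re_empiricalCharFun (t : ℂ) (n : ℕ) (y : Fin n → ℂ) :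
    (empiricalCharFun t n y).re = spectralAverage Real.cos t n y := by
  rw [empiricalCharFun, spectralAverage, ← Complex.ofReal_natCast, ← Complex.ofReal_inv,
    Complex.re_ofReal_mul, Complex.re_sum]
  simp only [Complex.exp_ofReal_mul_I_re]

lemma im_empiricalCharFun (t : ℂ) (n : ℕ) (y : Fin n → ℂ) :
    (empiricalCharFun t n y).im = spectralAverage Real.sin t n y := by
  rw [empiricalCharFun, spectralAverage, ← Complex.ofReal_natCast, ← Complex.ofReal_inv,
    Complex.im_ofReal_mul, Complex.im_sum]
  simp only [Complex.exp_ofReal_mul_I_im]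

/-- Equicontinuity in `t`. -/
lemma norm_empiricalCharFun_sub_le (s t : ℂ) {n : ℕ} (hn : 1 ≤ n) (y : Fin n → ℂ) :
    ‖empiricalCharFun t n y - empiricalCharFun s n y‖ ≤ ‖t - s‖ * (1 + meanNormSq n y) := by
  have hn0 : (0 : ℝ) < n := by exact_mod_cast hn
  have h1 : ∀ k, ‖Complex.exp (inner ℝ (normalizedDFT y k) t * Complex.I) -
      Complex.exp (inner ℝ (normalizedDFT y k) s * Complex.I)‖ ≤
      ‖t - s‖ * (1 + ‖normalizedDFT y k‖ ^ 2) := by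
    intro k
    set a : ℝ := inner ℝ (normalizedDFT y k) t with ha
    set b : ℝ := inner ℝ (normalizedDFT y k) s with hb
    have e1 : Complex.exp (a * Complex.I) - Complex.exp (b * Complex.I) =
        Complex.exp (b * Complex.I) * (Complex.exp (Complex.I * ((a - b : ℝ) : ℂ)) - 1) := by
      rw [mul_sub, ← Complex.exp_add, mul_one]
      congr 2
      push_cast
      ring
    rw [e1, norm_mul, Complex.norm_exp_ofReal_mul_I, one_mul]
    refine (Real.norm_exp_I_mul_ofReal_sub_one_le).trans ?_
    rw [ha, hb, ← inner_sub_right, Real.norm_eq_abs]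
    refine (abs_real_inner_le_norm _ _).trans ?_
    rw [mul_comm]
    refine mul_le_mul_of_nonneg_left ?_ (norm_nonneg _)
    nlinarith [sq_nonneg (‖normalizedDFT y k‖ - 1), norm_nonneg (normalizedDFT y k)]
  rw [empiricalCharFun, empiricalCharFun, ← mul_sub, ← Finset.sum_sub_distrib, norm_mul, norm_inv,
    Complex.norm_natCast, inv_mul_le_iff₀ hn0]
  refine (norm_sum_le _ _).trans ((Finset.sum_le_sum fun k _ => h1 k).trans_eq ?_)
  rw [← Finset.mul_sum, Finset.sum_add_distrib, sum_norm_sq_normalizedDFT, meanNormSq]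
  simp only [Finset.sum_const, Finset.card_univ, Fintype.card_fin, nsmul_eq_mul, mul_one]
  field_simp

section RandomEntries

variable {Ω : Type*} [MeasurableSpace Ω] (P : Measure Ω) [IsProbabilityMeasure P]
  (X : ℕ → Ω → ℂ)

lemma ae_tendsto_spectralAverage_sub_integral (hmeas : ∀ j, Measurable (X j))
    (hindep : iIndepFun X P) {C : ℝ}
    (hC : ∀ j s, 0 ≤ s → P.real {ω | s ≤ ‖X j ω‖} ≤ C / (1 + s) ^ 48)
    {φ ψ : ℝ → ℝ} (hφm : Measurable φ) (hφ1 : ∀ a, |φ a| ≤ 1) (hψ : ∀ a, |ψ a| ≤ 1)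
    (hφ : ∀ a b, |φ a - φ b - ψ a * (a - b)| ≤ 3 * (a - b) ^ 2) (t : ℂ) :
    ∀ᵐ ω ∂P, Tendsto (fun n : ℕ => spectralAverage φ t n (fun j => X j ω) -
      ∫ ω', spectralAverage φ t n (fun j => X j ω') ∂P) atTop (𝓝 0) := by
  have hXm : ∀ n : ℕ, Measurable fun ω => fun j : Fin n => X j ω := fun n =>
    measurable_pi_lambda _ fun j => hmeas j
  have hTm : ∀ n : ℕ, Measurable fun ω => fun j : Fin n => truncate (truncLevel n) (X j ω) :=
    fun n => measurable_pi_lambda _ fun j => (measurable_truncate _).comp (hmeas j)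
  have h1 := ae_tendsto_sub_integral_truncate P X hmeas hindep hC
    (F := spectralAverage φ t) (fun n => measurable_spectralAverage hφm t n) (b := fun _ => 1)
    (fun n K _ y _ => abs_spectralAverage_le hφ1 t n y)
    (fun n K hK y hy => sum_sq_spectralAverage_sub_update_le hψ hφ t n hK y hy)
  have hi : ∀ n, Integrable (fun ω => spectralAverage φ t n (fun j => X j ω)) P := fun n =>
    integrable_of_measurable_of_abs_le ((measurable_spectralAverage hφm t n).comp (hXm n))
      fun ω => abs_spectralAverage_le hφ1 t n _
  have hiT : ∀ n, Integrable
      (fun ω => spectralAverage φ t n (fun j => truncate (truncLevel n) (X j ω))) P := fun n =>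
    integrable_of_measurable_of_abs_le ((measurable_spectralAverage hφm t n).comp (hTm n))
      fun ω => abs_spectralAverage_le hφ1 t n _
  have h2 : Tendsto (fun n : ℕ =>
      ∫ ω, (spectralAverage φ t n (fun j => truncate (truncLevel n) (X j ω)) -
        spectralAverage φ t n (fun j => X j ω)) ∂P) atTop (𝓝 0) := by
    rw [← integral_zero Ω ℝ (μ := P)]
    refine tendsto_integral_of_dominated_convergence (fun _ => 2)
      (fun n => ((hiT n).sub (hi n)).aestronglyMeasurable) (integrable_const _)
      (fun n => Eventually.of_forall fun ω => ?_) ?_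
    · have e1 := abs_spectralAverage_le hφ1 t n fun j => truncate (truncLevel n) (X j ω)
      have e2 := abs_spectralAverage_le hφ1 t n fun j => X j ω
      rw [Real.norm_eq_abs]
      exact (abs_sub _ _).trans (by linarith)
    · filter_upwards [ae_eventually_truncate_eq P X hC] with ω hω
      refine tendsto_const_nhds.congr' ?_
      filter_upwards [hω] with n hn
      have : (fun j : Fin n => truncate (truncLevel n) (X j ω)) = fun j : Fin n => X j ω :=
        funext fun j => hn j j.2
      rw [this, sub_self]
  filter_upwards [h1] with ω hω
  have h3 := hω.add h2
  rw [add_zero] at h3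
  refine h3.congr fun n => ?_
  rw [integral_sub (hiT n) (hi n)]
  ring

lemma ae_eventually_meanNormSq_le (hmeas : ∀ j, Measurable (X j))
    (hindep : iIndepFun X P) (habs : ∀ j, ∫ ω, ‖X j ω‖ ^ 2 ∂P = 1) {C : ℝ}
    (hC : ∀ j s, 0 ≤ s → P.real {ω | s ≤ ‖X j ω‖} ≤ C / (1 + s) ^ 48) :
    ∀ᵐ ω ∂P, ∀ᶠ n : ℕ in atTop, meanNormSq n (fun j => X j ω) ≤ 2 := by
  have h1 := ae_tendsto_sub_integral_truncate P X hmeas hindep hC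
    (F := meanNormSq) measurable_meanNormSq (b := fun K => K ^ 2)
    (fun n K _ y hy => by
      rw [abs_of_nonneg (meanNormSq_nonneg n y)]
      exact meanNormSq_le hy)
    (fun n K _ y hy => sum_sq_meanNormSq_sub_update_le n y hy)
  have hX2 : ∀ j, Integrable (fun ω => ‖X j ω‖ ^ 2) P := fun j =>
    integrable_norm_sq_of_integral_eq_one (habs j)
  have h2 : ∀ n : ℕ, ∫ ω, meanNormSq n (fun j => truncate (truncLevel n) (X j ω)) ∂P ≤ 1 := by
    intro n
    have hle : ∀ j, ∫ ω, ‖truncate (truncLevel n) (X j ω)‖ ^ 2 ∂P ≤ 1 := fun j => by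
      rw [← habs j]
      exact integral_mono_of_nonneg (Eventually.of_forall fun ω => sq_nonneg _) (hX2 j)
        (Eventually.of_forall fun ω =>
          pow_le_pow_left₀ (norm_nonneg _) (norm_truncate_le_norm _ _) 2)
    simp only [meanNormSq]
    rw [integral_const_mul, integral_finsetSum _ fun j _ => ?_]
    · rcases Nat.eq_zero_or_pos n with rfl | hn
      · simp
      rw [inv_mul_le_iff₀ (by exact_mod_cast hn)]
      refine (Finset.sum_le_sum fun (j : Fin n) _ => hle j).trans_eq ?_
      simp
    · refine (hX2 j).mono' (((measurable_truncate _).comp (hmeas j)).norm.pow_const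
        2).aestronglyMeasurable (Eventually.of_forall fun ω => ?_)
      rw [norm_pow, norm_norm]
      exact pow_le_pow_left₀ (norm_nonneg _) (norm_truncate_le_norm _ _) 2
  filter_upwards [h1] with ω hω
  filter_upwards [hω.eventually (gt_mem_nhds one_pos)] with n hn
  linarith [h2 n]

lemma ae_tendsto_empiricalCharFun (hmeas : ∀ j, Measurable (X j))
    (hindep : iIndepFun X P) (α : ℂ) (hmean : ∀ j, ∫ ω, X j ω ∂P = 0)
    (hsq : ∀ j, ∫ ω, X j ω ^ 2 ∂P = α) (habs : ∀ j, ∫ ω, ‖X j ω‖ ^ 2 ∂P = 1) {C : ℝ}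
    (hC : ∀ j s, 0 ≤ s → P.real {ω | s ≤ ‖X j ω‖} ≤ C / (1 + s) ^ 48) (t : ℂ) :
    ∀ᵐ ω ∂P, Tendsto (fun n : ℕ => empiricalCharFun t n fun j => X j ω) atTop
      (𝓝 (Real.exp (-(‖t‖ ^ 2 / 4)) : ℂ)) := by
  obtain ⟨M, hM0, hM⟩ := exists_third_moment_bound P X hmeas hC
  have hlim := tendsto_integral_empiricalCharFun P X hmeas hindep α hmean hsq habs hM0 hM t
  have hXm : ∀ n : ℕ, Measurable fun ω => fun j : Fin n => X j ω := fun n =>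
    measurable_pi_lambda _ fun j => hmeas j
  have hi : ∀ n, Integrable (fun ω => empiricalCharFun t n (fun j : Fin n => X j ω)) P := by
    intro n
    refine Integrable.of_bound
      ((measurable_empiricalCharFun t n).comp (hXm n)).aestronglyMeasurable 2
      (Eventually.of_forall fun ω => ?_)
    refine (Complex.norm_le_abs_re_add_abs_im _).trans ?_
    rw [re_empiricalCharFun, im_empiricalCharFun]
    linarith [abs_spectralAverage_le Real.abs_cos_le_one t n fun j => X j ω,
      abs_spectralAverage_le Real.abs_sin_le_one t n fun j => X j ω]
  have hcos := ae_tendsto_spectralAverage_sub_integral P X hmeas hindep hC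
    Real.measurable_cos Real.abs_cos_le_one (ψ := fun a => -Real.sin a)
    (fun a => (abs_neg _).trans_le (Real.abs_sin_le_one a)) abs_cos_sub_cos_sub_le t
  have hsin := ae_tendsto_spectralAverage_sub_integral P X hmeas hindep hC
    Real.measurable_sin Real.abs_sin_le_one (ψ := Real.cos)
    Real.abs_cos_le_one abs_sin_sub_sin_sub_le t
  filter_upwards [hcos, hsin] with ω h1 h2
  have h3 := ((Complex.continuous_ofReal.tendsto _).comp h1).add
    (((Complex.continuous_ofReal.tendsto _).comp h2).mul_const Complex.I)
  have h4 := h3.add hlim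
  rw [Complex.ofReal_zero, zero_mul, zero_add, zero_add] at h4
  refine h4.congr fun n => ?_
  have e1 : (∫ ω', empiricalCharFun t n (fun j : Fin n => X j ω') ∂P).re =
      ∫ ω', spectralAverage Real.cos t n (fun j : Fin n => X j ω') ∂P := by
    have := integral_re (hi n)
    simp only [RCLike.re_eq_complex_re, re_empiricalCharFun] at this
    exact this.symm
  have e2 : (∫ ω', empiricalCharFun t n (fun j : Fin n => X j ω') ∂P).im =
      ∫ ω', spectralAverage Real.sin t n (fun j : Fin n => X j ω') ∂P := by
    have := integral_im (hi n)
    simp only [RCLike.im_eq_complex_im, im_empiricalCharFun] at this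
    exact this.symm
  simp only [Function.comp_apply]
  rw [← e1, ← e2, ← re_empiricalCharFun, ← im_empiricalCharFun]
  apply Complex.ext <;> simp

lemma ae_forall_tendsto_empiricalCharFun (hmeas : ∀ j, Measurable (X j))
    (hindep : iIndepFun X P) (α : ℂ) (hmean : ∀ j, ∫ ω, X j ω ∂P = 0)
    (hsq : ∀ j, ∫ ω, X j ω ^ 2 ∂P = α) (habs : ∀ j, ∫ ω, ‖X j ω‖ ^ 2 ∂P = 1) {C : ℝ}
    (hC : ∀ j s, 0 ≤ s → P.real {ω | s ≤ ‖X j ω‖} ≤ C / (1 + s) ^ 48) :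
    ∀ᵐ ω ∂P, ∀ t : ℂ, Tendsto (fun n : ℕ => empiricalCharFun t n fun j => X j ω) atTop
      (𝓝 (Real.exp (-(‖t‖ ^ 2 / 4)) : ℂ)) := by
  have hdense : ∀ᵐ ω ∂P, ∀ i : ℕ, Tendsto
      (fun n : ℕ => empiricalCharFun (TopologicalSpace.denseSeq ℂ i) n fun j => X j ω) atTop
      (𝓝 (Real.exp (-(‖TopologicalSpace.denseSeq ℂ i‖ ^ 2 / 4)) : ℂ)) :=
    ae_all_iff.mpr fun i =>
      ae_tendsto_empiricalCharFun P X hmeas hindep α hmean hsq habs hC _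
  filter_upwards [hdense, ae_eventually_meanNormSq_le P X hmeas hindep habs hC] with ω h1 h2 t
  have hcont : Continuous fun t : ℂ => (Real.exp (-(‖t‖ ^ 2 / 4)) : ℂ) := by fun_prop
  rw [Metric.tendsto_nhds]
  intro ε hε
  obtain ⟨δ, hδ, hδc⟩ := Metric.continuous_iff.mp hcont t (ε / 3) (by positivity)
  obtain ⟨i, hi⟩ := (TopologicalSpace.denseRange_denseSeq ℂ).exists_dist_lt t
    (lt_min hδ (by positivity : 0 < ε / 9))
  set s := TopologicalSpace.denseSeq ℂ i with hs
  have hc := hδc s (by rw [dist_comm]; exact hi.trans_le (min_le_left _ _))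
  filter_upwards [Metric.tendsto_nhds.mp (h1 i) (ε / 3) (by positivity), h2,
    eventually_ge_atTop 1] with n hn1 hn2 hn3
  have h5 := norm_empiricalCharFun_sub_le s t hn3 fun j => X j ω
  have h6 : ‖t - s‖ < ε / 9 := by
    rw [← dist_eq_norm]
    exact hi.trans_le (min_le_right _ _)
  have h7 : dist (empiricalCharFun t n fun j => X j ω) (empiricalCharFun s n fun j => X j ω) <
      ε / 3 := by
    rw [dist_eq_norm]
    nlinarith [norm_nonneg (t - s)]
  refine (dist_triangle4 _ (empiricalCharFun s n fun j => X j ω)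
    ((Real.exp (-(‖s‖ ^ 2 / 4)) : ℂ)) _).trans_lt ?_
  linarith

end RandomEntries

lemma weakStarTendsto_of_tendsto_empiricalCharFun {x : ℕ → ℂ}
    (h : ∀ t : ℂ, Tendsto (fun n : ℕ => empiricalCharFun t n fun j => x j) atTop
      (𝓝 (Real.exp (-(‖t‖ ^ 2 / 4)) : ℂ))) :
    WeakStarTendsto (fun n => circulantSpectralMeasure n x) stdComplexGaussian := by
  obtain ⟨γ, hγ⟩ : ∃ γ : ProbabilityMeasure ℂ, (γ : Measure ℂ) = stdComplexGaussian :=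
    ⟨⟨_, isProbabilityMeasure_stdComplexGaussian⟩, rfl⟩
  let μ : ℕ → ProbabilityMeasure ℂ := fun n =>
    ⟨circulantSpectralMeasure (n + 1) x, isProbabilityMeasure_circulantSpectralMeasure _ x⟩
  have hμ : Tendsto μ atTop (𝓝 γ) := by
    refine ProbabilityMeasure.tendsto_iff_tendsto_charFun.mpr fun t => ?_
    rw [hγ, charFun_stdComplexGaussian]
    refine ((tendsto_add_atTop_iff_nat 1).mpr (h t)).congr fun n => ?_
    exact (charFun_circulantSpectralMeasure (n + 1) x t).symm
  intro f
  have hf := (ProbabilityMeasure.tendsto_iff_forall_integral_tendsto.mp hμ) f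
  rw [hγ] at hf
  exact (tendsto_add_atTop_iff_nat 1).mp hf

theorem theorem2 {Ω : Type*} [MeasurableSpace Ω] (P : Measure Ω) [IsProbabilityMeasure P]
    (X : ℕ → Ω → ℂ) (hmeas : ∀ j, Measurable (X j)) (hindep : iIndepFun X P)
    (α : ℂ)
    (hmean : ∀ j, ∫ ω, X j ω ∂P = 0)
    (hsq : ∀ j, ∫ ω, X j ω ^ 2 ∂P = α)
    (habs : ∀ j, ∫ ω, ‖X j ω‖ ^ 2 ∂P = 1)
    (h : (∃ K : ℝ, 0 < K ∧ ∀ j, ∀ᵐ ω ∂P, ‖X j ω‖ ≤ K) ∨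
      (∃ K : ℝ, 0 < K ∧ ∀ j, QuadraticTransportInequality (P.map (X j)) K) ∨
      (∃ K : ℝ, 0 < K ∧ ∀ j, QuadraticTransportInequality' (P.map (X j)) K)) :
    ∀ᵐ ω ∂P,
      WeakStarTendsto (fun n => circulantSpectralMeasure n fun j => X j ω)
        stdComplexGaussian := by
  obtain ⟨C, hC⟩ := exists_uniform_tail P X hmeas habs h
  filter_upwards [ae_forall_tendsto_empiricalCharFun P X hmeas hindep α hmean hsq habs hC]
    with ω hω
  exact weakStarTendsto_of_tendsto_empiricalCharFun hω
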